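/- Let $p$ be a prime, $m\in\mathbb N$ and $q=p^m\ge 5$ with $3\mid\frac{q-1}{p-1}$, and put $n=\frac{q-1}{3}$. Let $\Gamma(3,q)$ be the graph whose vertices are the elements of the finite field $\mathbb F_q$, where $v$ and $w$ are adjacent if and only if $w-v\in\{x^3 : x\in\mathbb F_q^*\}$. Write $[\lambda]^e$ for an eigenvalue $\lambda$ of the adjacency matrix with multiplicity $e$; the eigenvalues listed in each spectrum below are pairwise distinct. Then $\Gamma(3,q)$ is connected, all its eigenvalues are integers, and its spectrum is as follows. (a) If $p\equiv 1\pmod 3$, then $m=3t$ for some $t\in\mathbb N$. There are integers $a,b$ with $$4\sqrt[3]{q}=a^2+27b^2,\qquad a\equiv 1\pmod 3,\qquad \gcd(a,p)=1,$$ where $a$ is uniquely determined and $b$ is uniquely determined up to sign, and for all such $a,b$ $$\mathrm{Spec}(\Gamma(3,q))=\Big\{[n]^1,\ \Big[\tfrac{a\sqrt[3]{q}-1}{3}\Big]^n,\ \Big[\tfrac{-\frac12(a+9b)\sqrt[3]{q}-1}{3}\Big]^n,\ \Big[\tfrac{-\frac12(a-9b)\sqrt[3]{q}-1}{3}\Big]^n\Big\}.$$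 (b) If $p\equiv 2\pmod 3$, then $m=2t$ for some $t\in\mathbb N$ and $$\mathrm{Spec}(\Gamma(3,q))=\begin{cases}\big\{[n]^1,\ \big[\tfrac{\sqrt q-1}{3}\big]^{2n},\ \big[\tfrac{-2\sqrt q-1}{3}\big]^{n}\big\} & \text{if } m\equiv 0\pmod 4,\\[2mm] \big\{[n]^1,\ \big[\tfrac{2\sqrt q-1}{3}\big]^{n},\ \big[\tfrac{-\sqrt q-1}{3}\big]^{2n}\big\} & \text{if } m\equiv 2\pmod 4.\end{cases}$$ In this case $\Gamma(3,q)$ is a strongly regular graph that is neither complete nor edgeless. -/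

import Mathlib

/-- The Cayley graph `X(G, S)` of an additive group with respect to a symmetric set `S` that does
not contain `0`: there is an edge from `v` to `w` when `w - v ∈ S`. -/
def cayleyGraph {G : Type*} [AddGroup G] (S : Set G) (h0 : (0 : G) ∉ S)
    (hS : ∀ s ∈ S, -s ∈ S) : SimpleGraph G where
  Adj v w := w - v ∈ S
  symm := ⟨fun v w h => by
    have h' := hS _ h
    rwa [neg_sub] at h'⟩
  loopless := ⟨fun v h => h0 (by rwa [sub_self] at h)⟩

/-- The set `R_k` of nonzero `k`-th powers of a field. -/
def nonzeroPowers (F : Type*) [Field F] (k : ℕ) : Set F :=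
  {y | ∃ x : F, x ≠ 0 ∧ y = x ^ k}

theorem zero_notMem_nonzeroPowers (F : Type*) [Field F] (k : ℕ) :
    (0 : F) ∉ nonzeroPowers F k := by
  rintro ⟨x, hx, h⟩
  exact pow_ne_zero k hx h.symm

theorem neg_mem_nonzeroPowers (F : Type*) [Field F] {k : ℕ} (hk : Odd k) :
    ∀ s ∈ nonzeroPowers F k, -s ∈ nonzeroPowers F k := by
  rintro s ⟨x, hx, rfl⟩
  exact ⟨-x, neg_ne_zero.mpr hx, (hk.neg_pow x).symm⟩

/-- The generalized Paley graph `Γ(3, q) = X(𝔽_q, R_3)`, on the elements of a field `F` with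
`q` elements; it is undirected because `-1 = (-1) ^ 3`. -/
def paleyGraph3 (F : Type*) [Field F] : SimpleGraph F :=
  cayleyGraph (nonzeroPowers F 3) (zero_notMem_nonzeroPowers F 3)
    (neg_mem_nonzeroPowers F (by decide))

open Classical in
/-- The spectrum of a finite graph: the multiset of the eigenvalues of its (real symmetric)
adjacency matrix, each repeated according to its multiplicity. -/
noncomputable def graphSpectrum {V : Type*} [Fintype V] (G : SimpleGraph V) : Multiset ℝ :=
  (G.adjMatrix ℝ).charpoly.roots

open Classical in
/-- A strongly regular graph (for some parameters), other than a complete or an edgeless graph. -/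
def IsStronglyRegular {V : Type*} [Fintype V] (G : SimpleGraph V) : Prop :=
  G ≠ ⊤ ∧ G ≠ ⊥ ∧ ∃ v k l μ : ℕ, G.IsSRGWith v k l μ

/-- The conditions `4 q^{1/3} = a² + 27 b²`, `a ≡ 1 (mod 3)` and `(a, p) = 1`. -/
def CubicConditions (p q : ℕ) (a b : ℤ) : Prop :=
  4 * (q : ℝ) ^ ((1 : ℝ) / 3) = (a : ℝ) ^ 2 + 27 * (b : ℝ) ^ 2 ∧
    a ≡ 1 [ZMOD 3] ∧ IsCoprime a (p : ℤ)

/-! ### Cubes in a finite field with `3 * n + 1` elements, and point counts of Fermat cubics. -/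

section CubesInFiniteField

open Finset

variable {F : Type*} [Field F] [Fintype F] {n : ℕ}

/-! The additive characters diagonalize the adjacency matrix, so each eigenvalue is k(c) = ∑ ψ(c y)
over the nonzero cubes y, and e = 3 k(c) + 1 is the cubic exponential sum at c. It depends only on
the cubic class of c: n comes from c = 0, and three further values occur n times each. As p - 1 ∣ n,
the prime field consists of cubes, which makes these values rational, hence integers.

Orthogonality turns the first three moments of the exponential sums into counts of zeros of diagonal
cubic forms (`exists_eigenvalues_paleyGraph3`): e₀ + e₁ + e₂ = 0, ∑ eᵢ² = 6q and ∑ eᵢ³ = 3qc with c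
= N - q + 2, N being the number of solutions of x³ + y³ = 1.

If p ≡ 2 mod 3, then q = s² and e₀² + e₀e₁ + e₁² = 3s². Since p is inert in the Eisenstein integers,
s divides every eᵢ, and a norm equation with value 3 remains; eᵢ ≡ 1 mod 3 fixes the sign. Strong
regularity is proved separately: Frobenius swaps the two classes of noncubes.

If p ≡ 1 mod 3, then q = s³ and every eᵢ satisfies e³ = s³(3e + c), so s ∣ eᵢ. The cofactors have
product c, and c ≡ -C(2n, n) mod p is nonzero by Lucas, so they are prime to p. Two of them agree
mod 9, and the third one is a. -/

theorem exists_generator_of_card (hq : Fintype.card F = 3 * n + 1) :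
    ∃ g : F, g ≠ 0 ∧ (∀ z : F, z ≠ 0 → ∃ k < 3 * n, g ^ k = z) ∧
      ∀ k : ℕ, g ^ k = 1 ↔ 3 * n ∣ k := by
  classical
  obtain ⟨g, hg⟩ := IsCyclic.exists_generator (α := Fˣ)
  have ho : orderOf g = 3 * n := by
    rw [orderOf_eq_card_of_forall_mem_zpowers hg, Nat.card_eq_fintype_card, Fintype.card_units, hq]
    rfl
  refine ⟨g, g.ne_zero, fun z hz => ?_, fun k => ?_⟩
  · have h := mem_zpowers_iff_mem_range_orderOf.mp (hg (Units.mk0 z hz))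
    rw [ho] at h
    obtain ⟨k, hk, hkz⟩ := mem_image.mp h
    refine ⟨k, mem_range.mp hk, ?_⟩
    have := congrArg Units.val hkz
    simpa using this
  · rw [← ho, orderOf_dvd_iff_pow_eq_one, ← Units.val_pow_eq_pow_val, Units.val_eq_one]

theorem pos_of_card (hq : Fintype.card F = 3 * n + 1) : 0 < n := by
  have := Fintype.one_lt_card (α := F)
  omega

theorem three_ne_zero_of_card (hq : Fintype.card F = 3 * n + 1) : (3 : F) ≠ 0 := by
  intro h
  have h1 : ((Fintype.card F : ℕ) : F) = 0 := FiniteField.cast_card_eq_zero F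
  rw [hq] at h1
  push_cast at h1
  rw [h] at h1
  simp at h1

theorem pow_three_mul_eq_one (hq : Fintype.card F = 3 * n + 1) {z : F} (hz : z ≠ 0) :
    z ^ (3 * n) = 1 := by
  have := FiniteField.pow_card_sub_one_eq_one z hz
  rwa [hq, Nat.add_sub_cancel] at this

theorem pow_eq_one_iff_exists_cube (hq : Fintype.card F = 3 * n + 1) {z : F} (hz : z ≠ 0) :
    z ^ n = 1 ↔ ∃ x : F, x ^ 3 = z := by
  constructor
  · intro h
    obtain ⟨g, hg0, hg, hgo⟩ := exists_generator_of_card hq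
    obtain ⟨k, -, rfl⟩ := hg z hz
    rw [← pow_mul, hgo] at h
    obtain ⟨j, rfl⟩ := Nat.dvd_of_mul_dvd_mul_right (pos_of_card hq) h
    exact ⟨g ^ j, by rw [← pow_mul, mul_comm]⟩
  · rintro ⟨x, rfl⟩
    rw [← pow_mul]
    refine pow_three_mul_eq_one hq ?_
    rintro rfl
    simp at hz

theorem exists_primitive_cube_root (hq : Fintype.card F = 3 * n + 1) :
    ∃ w : F, w ^ 2 + w + 1 = 0 := by
  obtain ⟨g, hg0, hg, hgo⟩ := exists_generator_of_card hq
  refine ⟨g ^ n, ?_⟩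
  have h1 : g ^ n ≠ 1 := by
    rw [Ne, hgo]
    intro h
    have := Nat.le_of_dvd (pos_of_card hq) h
    have := pos_of_card hq
    omega
  have h2 : (g ^ n - 1) * ((g ^ n) ^ 2 + g ^ n + 1) = 0 := by
    have := pow_three_mul_eq_one hq hg0
    rw [mul_comm 3 n, pow_mul] at this
    linear_combination this
  exact (mul_eq_zero.mp h2).resolve_left (sub_ne_zero.mpr h1)

/-- The number of cube roots of an element of a finite field. -/
def cubeRootCount [DecidableEq F] (z : F) : ℕ := #{x : F | x ^ 3 = z}

variable [DecidableEq F]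

theorem cubeRootCount_zero : cubeRootCount (0 : F) = 1 := by
  rw [cubeRootCount, card_eq_one]
  exact ⟨0, by ext; simp⟩

theorem cubeRootCount_cube (hq : Fintype.card F = 3 * n + 1) {a : F} (ha : a ≠ 0) :
    cubeRootCount (a ^ 3) = 3 := by
  obtain ⟨w, hw⟩ := exists_primitive_cube_root hq
  have h3 := three_ne_zero_of_card hq
  have hw1 : w ≠ 1 := by
    rintro rfl
    apply h3
    linear_combination hw
  have hw0 : w ≠ 0 := by
    rintro rfl
    simp at hw
  have : ({x : F | x ^ 3 = a ^ 3} : Finset F) = {a, w * a, w ^ 2 * a} := by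
    ext x
    simp only [mem_filter, mem_univ, true_and, mem_insert, mem_singleton]
    constructor
    · intro h
      have h' : (x - a) * ((x - w * a) * (x - w ^ 2 * a)) = 0 := by
        linear_combination h + (-x ^ 2 * a + x * a ^ 2 * w - (w - 1) * a ^ 3) * hw
      simpa [sub_eq_zero] using h'
    · rintro (rfl | rfl | rfl)
      · rfl
      · linear_combination (w - 1) * a ^ 3 * hw
      · linear_combination (w ^ 3 + 1) * (w - 1) * a ^ 3 * hw
  rw [cubeRootCount, this, card_insert_of_notMem, card_insert_of_notMem, card_singleton]
  · rw [mem_singleton]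
    intro h
    have := mul_right_cancel₀ ha h
    apply hw1
    apply mul_left_cancel₀ hw0
    linear_combination -this
  · rw [mem_insert, mem_singleton]
    rintro (h | h)
    · apply hw1
      apply mul_right_cancel₀ ha
      rw [← h, one_mul]
    · have h2 : w ^ 2 = 1 := mul_right_cancel₀ ha (by rw [← h, one_mul])
      have hw2 : w = -2 := by linear_combination hw - h2
      apply h3
      rw [hw2] at h2
      linear_combination h2

theorem cubeRootCount_of_not_cube {z : F} (h : ¬ ∃ x : F, x ^ 3 = z) : cubeRootCount z = 0 := by
  rw [cubeRootCount, card_eq_zero, filter_eq_empty_iff]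
  exact fun x _ hx => h ⟨x, hx⟩

/-- `z ^ n` is 0 at zero, 1 at nonzero cubes and a primitive cube root of unity elsewhere: a cubic
character with values in `F` itself. This makes counts modulo p accessible to power sums. -/
theorem cast_cubeRootCount (hq : Fintype.card F = 3 * n + 1) (z : F) :
    (cubeRootCount z : F) = 1 + z ^ n + z ^ (2 * n) := by
  have hn := pos_of_card hq
  rcases eq_or_ne z 0 with rfl | hz
  · rw [cubeRootCount_zero, zero_pow hn.ne', zero_pow (by omega)]
    simp
  · have h3 := pow_three_mul_eq_one hq hz
    by_cases h : ∃ x : F, x ^ 3 = z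
    · have h1 := (pow_eq_one_iff_exists_cube hq hz).mpr h
      obtain ⟨x, rfl⟩ := h
      rw [cubeRootCount_cube hq (by rintro rfl; simp at hz), mul_comm 2 n, pow_mul, h1]
      norm_num
    · rw [cubeRootCount_of_not_cube h]
      have h1 := mt (pow_eq_one_iff_exists_cube hq hz).mp h
      have : (z ^ n - 1) * (1 + z ^ n + z ^ (2 * n)) = 0 := by
        rw [mul_comm 2 n, pow_mul]
        rw [mul_comm 3 n, pow_mul] at h3
        linear_combination h3
      simpa using ((mul_eq_zero.mp this).resolve_left (sub_ne_zero.mpr h1)).symm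

theorem sum_comp_cube {M : Type*} [CommSemiring M] (f : F → M) :
    ∑ x : F, f (x ^ 3) = ∑ z : F, (cubeRootCount z : M) * f z := by
  rw [← sum_fiberwise univ (fun x : F => x ^ 3)]
  refine sum_congr rfl fun z _ => ?_
  rw [cubeRootCount, ← nsmul_eq_mul, ← sum_const]
  refine sum_congr rfl fun x hx => ?_
  rw [(mem_filter.mp hx).2]

theorem sum_comp_cube_eq_add (hq : Fintype.card F = 3 * n + 1) {M : Type*} [CommSemiring M]
    (f : F → M) (s : Finset F) (hs : ∀ z, z ∈ s ↔ z ∈ nonzeroPowers F 3) :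
    ∑ x : F, f (x ^ 3) = f 0 + 3 * ∑ z ∈ s, f z := by
  have h0 : (0 : F) ∉ s := by
    rw [hs]
    exact zero_notMem_nonzeroPowers F 3
  rw [sum_comp_cube, mul_sum, ← sum_subset (subset_univ (insert 0 s)), sum_insert h0,
    cubeRootCount_zero]
  · congr 1
    · simp
    · refine sum_congr rfl fun z hz => ?_
      obtain ⟨x, hx, rfl⟩ := (hs z).mp hz
      rw [cubeRootCount_cube hq hx]
      norm_num
  · intro z _ hz
    rw [mem_insert, not_or] at hz
    rw [cubeRootCount_of_not_cube, Nat.cast_zero, zero_mul]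
    rintro ⟨x, rfl⟩
    exact hz.2 ((hs _).mpr ⟨x, by rintro rfl; simp at hz, rfl⟩)

theorem card_nonzero_cubes (hq : Fintype.card F = 3 * n + 1) (s : Finset F)
    (hs : ∀ z, z ∈ s ↔ z ∈ nonzeroPowers F 3) : #s = n := by
  have := sum_comp_cube_eq_add hq (fun _ => (1 : ℕ)) s hs
  simp [hq] at this
  omega

/-- The number of solutions of `x ^ 3 + y ^ 3 = z`. -/
def cubeSumCount (z : F) : ℕ := #{x : F × F | x.1 ^ 3 + x.2 ^ 3 = z}

theorem cubeSumCount_eq_sum (z : F) : cubeSumCount z = ∑ y : F, cubeRootCount (z - y ^ 3) := by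
  rw [cubeSumCount, card_filter, Fintype.sum_prod_type_right]
  refine sum_congr rfl fun y _ => ?_
  rw [cubeRootCount, card_filter]
  simp only [eq_sub_iff_add_eq]

theorem cubeSumCount_zero (hq : Fintype.card F = 3 * n + 1) :
    cubeSumCount (0 : F) = 1 + 3 * (3 * n) := by
  rw [cubeSumCount_eq_sum, ← add_sum_erase univ _ (mem_univ (0 : F))]
  congr 1
  · simp [cubeRootCount_zero]
  · rw [sum_congr rfl (g := fun _ => 3), sum_const, card_erase_of_mem (mem_univ _), card_univ, hq]
    · simp; ring
    · intro y hy
      rw [zero_sub, ← Odd.neg_pow (by decide), cubeRootCount_cube hq]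
      exact neg_ne_zero.mpr (ne_of_mem_erase hy)

theorem cubeSumCount_neg_cube {z : F} (hz : z ≠ 0) :
    cubeSumCount (-z ^ 3) = cubeSumCount (1 : F) := by
  symm
  refine card_bij (fun x _ => (-z * x.1, -z * x.2)) ?_ ?_ ?_
  · intro x hx
    simp only [mem_filter, mem_univ, true_and] at hx ⊢
    linear_combination -z ^ 3 * hx
  · rintro ⟨a, b⟩ _ ⟨c, d⟩ _ h
    simpa [hz] using h
  · rintro ⟨a, b⟩ h
    simp only [mem_filter, mem_univ, true_and] at h
    refine ⟨(-z⁻¹ * a, -z⁻¹ * b), ?_, ?_⟩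
    · simp only [mem_filter, mem_univ, true_and]
      have : z⁻¹ ^ 3 * z ^ 3 = 1 := by rw [← mul_pow, inv_mul_cancel₀ hz, one_pow]
      linear_combination -z⁻¹ ^ 3 * h + this
    · ext <;> field_simp

theorem sum_pow_eq_neg_ite (hq : Fintype.card F = 3 * n + 1) {i : ℕ} (hi : i < 2 * (3 * n)) :
    ∑ x : F, x ^ i = if i = 3 * n then -1 else 0 := by
  have hn := pos_of_card hq
  -- The exponent 0 is exceptional: since `0 ^ 0 = 1`, the sum is q = 0 and not -1.
  rcases Nat.eq_zero_or_pos i with rfl | h0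
  · simp only [pow_zero, sum_const, card_univ, nsmul_eq_mul, mul_one,
      FiniteField.cast_card_eq_zero]
    rw [if_neg (by omega)]
  · have h1 := FiniteField.sum_pow_units F i
    have h2 : ∑ x : F, x ^ i = ∑ x : Fˣ, (x : F) ^ i := by
      rw [← add_sum_erase univ _ (mem_univ (0 : F)), zero_pow h0.ne', zero_add]
      symm
      refine sum_bij (fun x _ => (x : F)) (by simp) (by simp [Units.ext_iff]) ?_ (by simp)
      intro x hx
      exact ⟨Units.mk0 x (ne_of_mem_erase hx), mem_univ _, rfl⟩
    rw [h2, h1, hq, Nat.add_sub_cancel]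
    congr 1
    rw [eq_iff_iff]
    constructor
    · rintro ⟨k, rfl⟩
      have : k < 2 := by
        by_contra! h
        nlinarith
      have : k = 1 := by
        interval_cases k <;> omega
      simp [this]
    · rintro rfl
      rfl

theorem sum_pow_mul_one_sub_pow (hq : Fintype.card F = 3 * n + 1) {i j : ℕ} (hi : i ≤ 2)
    (hj : j ≤ 2) : ∑ x : F, x ^ (i * n) * (1 - x) ^ (j * n) =
      if 3 ≤ i + j then -((-1) ^ ((3 - i) * n) * ((j * n).choose ((3 - i) * n) : F)) else 0 := by
  have hn := pos_of_card hq
  have h1 : ∀ x : F, x ^ (i * n) * (1 - x) ^ (j * n) =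
      ∑ k ∈ range (j * n + 1), (-1) ^ k * ((j * n).choose k : F) * x ^ (k + i * n) := by
    intro x
    rw [sub_eq_neg_add, add_pow, mul_sum]
    refine sum_congr rfl fun k _ => ?_
    rw [one_pow, neg_pow]
    ring
  simp_rw [h1]
  rw [sum_comm]
  simp_rw [← mul_sum]
  -- All exponents are at most 4n < 6n, so only the monomial of degree 3n = q - 1 survives.
  have h2 : ∀ k ∈ range (j * n + 1), (-1) ^ k * ((j * n).choose k : F) * ∑ x : F, x ^ (k + i * n) =
      if k = (3 - i) * n then -((-1) ^ k * ((j * n).choose k : F)) else 0 := by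
    intro k hk
    have hk' := mem_range.mp hk
    have : i * n ≤ 2 * n := Nat.mul_le_mul_right n hi
    have : j * n ≤ 2 * n := Nat.mul_le_mul_right n hj
    rw [sum_pow_eq_neg_ite hq (by omega)]
    have : (3 - i) * n + i * n = 3 * n := by
      rw [← Nat.add_mul]
      congr 1
      omega
    by_cases h : k = (3 - i) * n
    · rw [if_pos h, if_pos (by omega)]
      ring
    · rw [if_neg h, if_neg (by omega), mul_zero]
  rw [sum_congr rfl h2, sum_ite_eq']
  by_cases h : 3 ≤ i + j
  · rw [if_pos h, if_pos]
    rw [mem_range, Nat.lt_succ_iff]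
    exact Nat.mul_le_mul_right n (by omega)
  · rw [if_neg h, if_neg]
    rw [mem_range, Nat.lt_succ_iff, not_le]
    exact Nat.mul_lt_mul_of_pos_right (by omega) hn

/-- The number of points of the affine Fermat cubic, modulo the characteristic. -/
theorem cast_cubeSumCount_one (hq : Fintype.card F = 3 * n + 1) :
    (cubeSumCount (1 : F) : F) = -2 - ((2 * n).choose n : F) := by
  have hpar : ∀ k : ℕ, ((-1 : F)) ^ (n * k) = 1 := by
    intro k
    rw [pow_mul, (pow_eq_one_iff_exists_cube hq (neg_ne_zero.mpr one_ne_zero)).mpr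
      ⟨-1, by norm_num⟩, one_pow]
  have h1 : (cubeSumCount (1 : F) : F) =
      ∑ u : F, (1 + u ^ n + u ^ (2 * n)) * (1 + (1 - u) ^ n + (1 - u) ^ (2 * n)) := by
    rw [cubeSumCount_eq_sum, Nat.cast_sum,
      sum_comp_cube (fun z : F => ((cubeRootCount (1 - z) : ℕ) : F))]
    exact sum_congr rfl fun u _ => by rw [cast_cubeRootCount hq, cast_cubeRootCount hq]
  have h2 : (cubeSumCount (1 : F) : F) =
      ∑ i ∈ range 3, ∑ j ∈ range 3, ∑ u : F, u ^ (i * n) * (1 - u) ^ (j * n) := by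
    rw [h1, sum_congr rfl fun i _ => sum_comm, sum_comm]
    refine sum_congr rfl fun u _ => ?_
    simp only [sum_range_succ, sum_range_zero, zero_mul, one_mul, pow_zero]
    ring
  rw [h2, sum_congr rfl fun i hi => sum_congr rfl fun j hj => sum_pow_mul_one_sub_pow hq
    (Nat.lt_succ_iff.mp (mem_range.mp hi)) (Nat.lt_succ_iff.mp (mem_range.mp hj))]
  have e1 := hpar 1
  have e2 := hpar 2
  rw [mul_one] at e1
  rw [mul_comm] at e2
  -- Only the pairs (1,2), (2,1) and (2,2) contribute: -1, -1 and the binomial term.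
  simp [sum_range_succ, e1, e2]
  ring

end CubesInFiniteField

/-! ### Cubic exponential sums, their moments, and spectra of Cayley graphs. -/

section CubicExponentialSums

open Finset

/-- The sum is an algebraic integer, being built from p-th roots of unity. It is unchanged when its
argument is multiplied by u = 1, …, p - 1; adding all these copies and the term u = 0 gives p times
a count, so it is also rational. -/
theorem exists_int_eq_sum_addChar {F : Type*} [Field F] {p : ℕ} (hp : p.Prime) [CharP F p]
    (ψ : AddChar F ℂ) (s : Finset F)
    (hs : ∀ u : ℕ, ¬ p ∣ u → ∀ y, (u : F) * y ∈ s ↔ y ∈ s) (c : F) :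
    ∃ k : ℤ, ∑ y ∈ s, ψ (c * y) = k := by
  have hpow : ∀ y : F, ψ y ^ p = 1 := by
    intro y
    rw [← AddChar.map_nsmul_eq_pow, nsmul_eq_mul, CharP.cast_eq_zero, zero_mul,
      AddChar.map_zero_eq_one]
  have hint : IsIntegral ℤ (∑ y ∈ s, ψ (c * y)) := by
    refine IsIntegral.sum _ fun y _ => IsIntegral.of_pow hp.pos ?_
    rw [hpow]
    exact isIntegral_one
  have hgeom : ∀ y : F, ∑ u ∈ range p, ψ (u * (c * y)) = if ψ (c * y) = 1 then (p : ℂ) else 0 := by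
    intro y
    have : ∀ u ∈ range p, ψ (u * (c * y)) = ψ (c * y) ^ u := by
      intro u _
      rw [← AddChar.map_nsmul_eq_pow, nsmul_eq_mul]
    rw [sum_congr rfl this]
    split_ifs with h
    · simp [h]
    · rw [geom_sum_eq h, hpow]
      simp
  have hshift : ∀ u ∈ (range p).erase 0, ∑ y ∈ s, ψ (u * (c * y)) = ∑ y ∈ s, ψ (c * y) := by
    intro u hu
    obtain ⟨hu0, hup⟩ := mem_erase.mp hu
    have hpu : ¬ p ∣ u := fun h => hu0 (Nat.eq_zero_of_dvd_of_lt h (mem_range.mp hup))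
    have hu' : (u : F) ≠ 0 := by rwa [Ne, CharP.cast_eq_zero_iff F p]
    refine sum_bij (fun y _ => (u : F) * y) (fun y hy => (hs u hpu y).mpr hy)
      (fun a _ b _ h => mul_left_cancel₀ hu' h) (fun b hb => ?_) (fun y _ => by ring_nf)
    refine ⟨(u : F)⁻¹ * b, ?_, by field_simp⟩
    rw [← hs u hpu, mul_inv_cancel_left₀ hu']
    exact hb
  have hkey : (#s : ℂ) + ((p - 1 : ℕ) : ℂ) * ∑ y ∈ s, ψ (c * y) =
      ∑ y ∈ s, if ψ (c * y) = 1 then (p : ℂ) else 0 := by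
    rw [← sum_congr rfl fun y _ => hgeom y, sum_comm,
      ← add_sum_erase (range p) _ (mem_range.mpr hp.pos), sum_congr rfl hshift, sum_const,
      card_erase_of_mem (mem_range.mpr hp.pos), card_range]
    simp
  rw [← sum_filter, sum_const, nsmul_eq_mul] at hkey
  set M := #{y ∈ s | ψ (c * y) = 1}
  have hp1 : ((p - 1 : ℕ) : ℂ) ≠ 0 := by
    have := hp.two_le
    exact_mod_cast (by omega : p - 1 ≠ 0)
  have hrat : ∑ y ∈ s, ψ (c * y) =
      algebraMap ℚ ℂ (((M : ℚ) * p - #s) / ((p - 1 : ℕ) : ℚ)) := by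
    simp only [map_div₀, map_sub, map_mul, map_natCast]
    rw [eq_div_iff hp1]
    linear_combination hkey
  rw [hrat] at hint ⊢
  rw [isIntegral_algebraMap_iff (algebraMap ℚ ℂ).injective] at hint
  obtain ⟨k, hk⟩ := IsIntegrallyClosed.isIntegral_iff.mp hint
  exact ⟨k, by rw [← hk]; simp⟩

variable {F : Type*} [Field F] [Fintype F] {n : ℕ}

theorem map_range_three_mul {α : Type*} (h : ℕ → α) (hh : ∀ k, h (k + 3) = h k) (n : ℕ) :
    (Multiset.range (3 * n)).map h = n • ({h 0, h 1, h 2} : Multiset α) := by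
  have hm : ∀ k j, h (3 * k + j) = h j := by
    intro k j
    induction k with
    | zero => simp
    | succ k ih => rw [← ih, ← hh (3 * k + j)]; congr 1; ring
  induction n with
  | zero => simp
  | succ n ih =>
    rw [show 3 * (n + 1) = 3 * n + 1 + 1 + 1 by ring, Multiset.range_succ, Multiset.range_succ,
      Multiset.range_succ, Multiset.map_cons, Multiset.map_cons, Multiset.map_cons, ih, succ_nsmul,
      hm n 1, show h (3 * n) = h 0 by simpa using hm n 0, show 3 * n + 1 + 1 = 3 * n + 2 by ring,
      hm n 2]
    simp only [Multiset.insert_eq_cons, ← Multiset.singleton_add]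
    abel

/-- The values of a function that is invariant under multiplication by nonzero cubes. -/
theorem map_univ_of_cube_invariant (hq : Fintype.card F = 3 * n + 1) {α : Type*} (f : F → α)
    (hf : ∀ c a : F, a ≠ 0 → f (c * a ^ 3) = f c) :
    ∃ g : F, g ≠ 0 ∧ (univ : Finset F).val.map f =
      {f 0} + n • ({f 1, f g, f (g ^ 2)} : Multiset α) := by
  classical
  obtain ⟨g, hg0, hg, hgo⟩ := exists_generator_of_card hq
  refine ⟨g, hg0, ?_⟩
  have hinj : Set.InjOn (fun k : ℕ => g ^ k) (range (3 * n) : Finset ℕ) := by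
    intro a ha b hb h
    simp only [coe_range, Set.mem_Iio] at ha hb
    wlog hab : a ≤ b generalizing a b
    · exact (this h.symm hb ha (by omega)).symm
    obtain ⟨d, rfl⟩ := Nat.exists_eq_add_of_le hab
    have h1 : g ^ d = 1 := by
      simp only [pow_add] at h
      exact mul_left_cancel₀ (pow_ne_zero a hg0) (by rw [← h, mul_one])
    rw [hgo] at h1
    have := Nat.eq_zero_of_dvd_of_lt h1 (by omega)
    omega
  have huniv : (univ : Finset F) = insert 0 ((range (3 * n)).image fun k : ℕ => g ^ k) := by
    ext z
    simp only [mem_univ, mem_insert, mem_image, mem_range, true_iff]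
    rcases eq_or_ne z 0 with h | h
    · exact Or.inl h
    · exact Or.inr (hg z h)
  rw [huniv, insert_val_of_notMem, image_val_of_injOn hinj, Multiset.map_cons, Multiset.map_map,
    range_val, map_range_three_mul (f ∘ fun k : ℕ => g ^ k), ← Multiset.singleton_add]
  · simp
  · intro k
    simp only [Function.comp, pow_add]
    exact hf _ g hg0
  · simp only [mem_image, not_exists, not_and]
    exact fun k _ => pow_ne_zero k hg0

/-- The exponential sum `∑ x, ψ (c * x ^ 3)`. -/
noncomputable def cubicSum (ψ : AddChar F ℂ) (c : F) : ℂ := ∑ x : F, ψ (c * x ^ 3)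

theorem cubicSum_mul_cube (ψ : AddChar F ℂ) (c : F) {a : F} (ha : a ≠ 0) :
    cubicSum ψ (c * a ^ 3) = cubicSum ψ c := by
  unfold cubicSum
  refine Fintype.sum_equiv (Equiv.mulLeft₀ a ha) _ _ fun x => ?_
  simp [mul_pow, mul_assoc]

/-- Orthogonality of characters; applied to sums of one, two or three cubes, it converts moments of
`cubicSum` into numbers of zeros. -/
theorem sum_sum_addChar_mul [DecidableEq F] {ψ : AddChar F ℂ} (hψ : ψ.IsPrimitive) {ι : Type*}
    [Fintype ι] (f : ι → F) :
    ∑ c : F, ∑ i, ψ (c * f i) = Fintype.card F * #{i | f i = 0} := by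
  rw [sum_comm, card_filter, Nat.cast_sum, mul_sum]
  refine sum_congr rfl fun i _ => ?_
  rw [AddChar.sum_mulShift _ hψ]
  split_ifs <;> simp

theorem sum_cubicSum [DecidableEq F] {ψ : AddChar F ℂ} (hψ : ψ.IsPrimitive) :
    ∑ c, cubicSum ψ c = Fintype.card F := by
  unfold cubicSum
  rw [sum_sum_addChar_mul hψ]
  have := cubeRootCount_zero (F := F)
  rw [cubeRootCount] at this
  rw [this]
  simp

theorem sum_cubicSum_sq [DecidableEq F] (hq : Fintype.card F = 3 * n + 1) {ψ : AddChar F ℂ} (hψ : ψ.IsPrimitive) :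
    ∑ c, cubicSum ψ c ^ 2 = Fintype.card F * (1 + 3 * (3 * n)) := by
  have h : ∀ c, cubicSum ψ c ^ 2 = ∑ x : F × F, ψ (c * (x.1 ^ 3 + x.2 ^ 3)) := by
    intro c
    rw [sq, cubicSum, Fintype.sum_mul_sum, Fintype.sum_prod_type]
    simp only [mul_add, AddChar.map_add_eq_mul]
  simp_rw [h]
  rw [sum_sum_addChar_mul hψ]
  have := cubeSumCount_zero hq
  rw [cubeSumCount] at this
  rw [this]
  push_cast
  ring

/-- Fibre over the third coordinate: each of its 3n nonzero values gives a rescaled copy of the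
affine Fermat cubic. -/
theorem card_cubic_cone [DecidableEq F] (hq : Fintype.card F = 3 * n + 1) :
    #{x : F × F × F | x.2.1 ^ 3 + x.2.2 ^ 3 + x.1 ^ 3 = 0} =
      1 + 3 * (3 * n) + 3 * n * cubeSumCount (1 : F) := by
  have h : #{x : F × F × F | x.2.1 ^ 3 + x.2.2 ^ 3 + x.1 ^ 3 = 0} =
      ∑ z : F, cubeSumCount (-z ^ 3) := by
    rw [card_filter, Fintype.sum_prod_type]
    refine sum_congr rfl fun z _ => ?_
    rw [cubeSumCount, card_filter]
    simp only [add_eq_zero_iff_eq_neg]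
  rw [h, ← add_sum_erase univ _ (mem_univ (0 : F))]
  congr 1
  · simp [cubeSumCount_zero hq]
  · rw [sum_congr rfl fun z hz => cubeSumCount_neg_cube (ne_of_mem_erase hz), sum_const,
      card_erase_of_mem (mem_univ _), card_univ, hq, smul_eq_mul, Nat.add_sub_cancel]

theorem sum_cubicSum_cube [DecidableEq F] (hq : Fintype.card F = 3 * n + 1) {ψ : AddChar F ℂ}
    (hψ : ψ.IsPrimitive) : ∑ c, cubicSum ψ c ^ 3 =
      Fintype.card F * (1 + 3 * (3 * n) + 3 * n * cubeSumCount (1 : F)) := by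
  have h : ∀ c, cubicSum ψ c ^ 3 =
      ∑ x : F × F × F, ψ (c * (x.2.1 ^ 3 + x.2.2 ^ 3 + x.1 ^ 3)) := by
    intro c
    rw [pow_succ', sq, cubicSum, Fintype.sum_mul_sum, Fintype.sum_mul_sum, Fintype.sum_prod_type]
    refine sum_congr rfl fun z _ => ?_
    rw [Fintype.sum_prod_type]
    refine sum_congr rfl fun x _ => ?_
    rw [mul_sum]
    refine sum_congr rfl fun y _ => ?_
    simp only [mul_add, AddChar.map_add_eq_mul]
    ring
  simp_rw [h]
  rw [sum_sum_addChar_mul hψ, card_cubic_cone hq]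
  push_cast
  ring

/-- The spectrum of a Cayley graph whose character sums are integers. -/
theorem graphSpectrum_cayleyGraph {ψ : AddChar F ℂ} (hψ : ψ.IsPrimitive) (S : Set F)
    (h0 : (0 : F) ∉ S) (hS : ∀ s ∈ S, -s ∈ S) (s : Finset F) (hs : ∀ z, z ∈ s ↔ z ∈ S)
    (k : F → ℤ) (hk : ∀ c, ∑ y ∈ s, ψ (c * y) = k c) :
    graphSpectrum (cayleyGraph S h0 hS) = (univ : Finset F).val.map fun c => (k c : ℝ) := by
  classical
  have hq0 : (Fintype.card F : ℂ) ≠ 0 := by exact_mod_cast Fintype.card_ne_zero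
  -- `P` has the characters as columns; orthogonality makes `Q` its inverse.
  let P : Matrix F F ℂ := Matrix.of fun v c => ψ (c * v)
  let Q : Matrix F F ℂ := Matrix.of fun c v => (Fintype.card F : ℂ)⁻¹ * ψ (-(c * v))
  have hPQ : P * Q = 1 := by
    ext v w
    simp only [P, Q, Matrix.mul_apply, Matrix.of_apply]
    have : ∀ c ∈ (univ : Finset F), ψ (c * v) * ((Fintype.card F : ℂ)⁻¹ * ψ (-(c * w))) =
        (Fintype.card F : ℂ)⁻¹ * ψ (c * (v - w)) := by
      intro c _
      rw [mul_sub, sub_eq_add_neg, AddChar.map_add_eq_mul]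
      ring
    rw [sum_congr rfl this, ← mul_sum, AddChar.sum_mulShift _ hψ, Matrix.one_apply]
    by_cases h : v = w
    · simp [h]
    · simp [h, sub_ne_zero.mpr h]
  have hQP : Q * P = 1 := mul_eq_one_comm.mp hPQ
  let D : Matrix F F ℂ := Matrix.diagonal fun c => (k c : ℂ)
  have hAP : (cayleyGraph S h0 hS).adjMatrix ℂ * P = P * D := by
    ext v c
    simp only [D, P, Matrix.mul_diagonal, SimpleGraph.adjMatrix_mul_apply, Matrix.of_apply]
    rw [← hk, mul_sum]
    symm
    refine sum_bij (fun y _ => v + y) (fun y hy => ?_) (fun a _ b _ h => add_left_cancel h)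
      (fun w hw => ?_) (fun y _ => ?_)
    · rw [SimpleGraph.mem_neighborFinset]
      change v + y - v ∈ S
      rw [add_sub_cancel_left, ← hs]
      exact hy
    · rw [SimpleGraph.mem_neighborFinset] at hw
      exact ⟨w - v, (hs _).mpr hw, by ring⟩
    · rw [← AddChar.map_add_eq_mul, ← mul_add]
  have hA : (cayleyGraph S h0 hS).adjMatrix ℂ = P * D * Q := by
    rw [← hAP, mul_assoc, hPQ, mul_one]
  have hchar : ((cayleyGraph S h0 hS).adjMatrix ℝ).charpoly =
      ∏ c : F, (Polynomial.X - Polynomial.C ((k c : ℝ))) := by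
    -- The diagonalization lives over ℂ, whereas the spectrum is defined over ℝ.
    apply Polynomial.map_injective (algebraMap ℝ ℂ) (algebraMap ℝ ℂ).injective
    rw [← Matrix.charpoly_map, Polynomial.map_prod]
    have : ((cayleyGraph S h0 hS).adjMatrix ℝ).map (algebraMap ℝ ℂ) =
        (cayleyGraph S h0 hS).adjMatrix ℂ := by
      ext v w
      simp only [Matrix.map_apply, SimpleGraph.adjMatrix_apply]
      split_ifs <;> simp
    rw [this, hA, Matrix.charpoly_mul_comm, ← mul_assoc, hQP, one_mul, Matrix.charpoly_diagonal]
    simp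
  have hroots := Polynomial.roots_multiset_prod_X_sub_C
    ((univ : Finset F).val.map fun c => (k c : ℝ))
  rw [Multiset.map_map] at hroots
  rw [graphSpectrum, ← hroots]
  congr 1

end CubicExponentialSums

/-! ### Power sums of the eigenvalues, connectedness and strong regularity. -/

section PaleyGraphStructure

open Finset

theorem mul_mem_closure_nonzeroPowers {F : Type*} [Field F] {k : ℕ} {a b : F}
    (ha : a ∈ AddSubgroup.closure (nonzeroPowers F k))
    (hb : b ∈ AddSubgroup.closure (nonzeroPowers F k)) :
    a * b ∈ AddSubgroup.closure (nonzeroPowers F k) := by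
  induction ha using AddSubgroup.closure_induction with
  | mem x hx =>
    induction hb using AddSubgroup.closure_induction with
    | mem y hy =>
      obtain ⟨u, hu, rfl⟩ := hx
      obtain ⟨v, hv, rfl⟩ := hy
      exact AddSubgroup.subset_closure ⟨u * v, mul_ne_zero hu hv, (mul_pow u v k).symm⟩
    | zero => rw [mul_zero]; exact zero_mem _
    | add y z _ _ hy hz => rw [mul_add]; exact add_mem hy hz
    | neg y _ hy => rw [mul_neg]; exact neg_mem hy
  | zero => rw [zero_mul]; exact zero_mem _
  | add y z _ _ hy hz => rw [add_mul]; exact add_mem hy hz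
  | neg y _ hy => rw [neg_mul]; exact neg_mem hy

variable {F : Type*} [Field F] [Fintype F] {n : ℕ}

theorem mem_nonzeroPowers_three_iff (hq : Fintype.card F = 3 * n + 1) {z : F} :
    z ∈ nonzeroPowers F 3 ↔ z ^ n = 1 := by
  constructor
  · rintro ⟨x, hx, rfl⟩
    rw [← pow_mul]
    exact pow_three_mul_eq_one hq hx
  · intro h
    have hz : z ≠ 0 := by
      rintro rfl
      rw [zero_pow (pos_of_card hq).ne'] at h
      exact zero_ne_one h
    obtain ⟨x, rfl⟩ := (pow_eq_one_iff_exists_cube hq hz).mp h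
    exact ⟨x, by rintro rfl; simp at hz, rfl⟩

/-- By Fermat and p - 1 ∣ n, `u ^ n = 1`: nonzero elements of the prime field are cubes. The
integrality of the spectrum rests on this. -/
theorem natCast_mul_mem_nonzeroPowers_iff (hq : Fintype.card F = 3 * n + 1) {p : ℕ} (hp : p.Prime)
    [CharP F p] (hpn : p - 1 ∣ n) {u : ℕ} (hu : ¬ p ∣ u) (y : F) :
    (u : F) * y ∈ nonzeroPowers F 3 ↔ y ∈ nonzeroPowers F 3 := by
  have h1 : (u : F) ^ (p - 1) = 1 := by
    have h := Nat.ModEq.pow_totient ((hp.coprime_iff_not_dvd.mpr hu).symm)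
    rw [Nat.totient_prime hp, ← CharP.natCast_eq_natCast F p] at h
    exact_mod_cast h
  obtain ⟨j, rfl⟩ := hpn
  rw [mem_nonzeroPowers_three_iff hq, mem_nonzeroPowers_three_iff hq, mul_pow, pow_mul, h1,
    one_pow, one_mul]

/-- The nontrivial eigenvalues of the cubic Paley graph, through their power sums. -/
theorem exists_eigenvalues_paleyGraph3 [DecidableEq F] (hq : Fintype.card F = 3 * n + 1) {p : ℕ}
    (hp : p.Prime) [CharP F p] (hpn : p - 1 ∣ n) :
    ∃ k₀ k₁ k₂ : ℤ, k₀ + k₁ + k₂ = -1 ∧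
      (3 * k₀ + 1) ^ 2 + (3 * k₁ + 1) ^ 2 + (3 * k₂ + 1) ^ 2 = 6 * (3 * n + 1) ∧
      (3 * k₀ + 1) ^ 3 + (3 * k₁ + 1) ^ 3 + (3 * k₂ + 1) ^ 3 =
        3 * ((3 * n + 1) * (cubeSumCount (1 : F) - 3 * n + 1)) ∧
      graphSpectrum (paleyGraph3 F) =
        {(n : ℝ)} + n • ({(k₀ : ℝ), (k₁ : ℝ), (k₂ : ℝ)} : Multiset ℝ) := by
  classical
  have hn0 : (n : ℂ) ≠ 0 := by exact_mod_cast (pos_of_card hq).ne'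
  obtain ⟨ψ, hψ⟩ : ∃ ψ : AddChar F ℂ, ψ.IsPrimitive :=
    ⟨_, AddChar.FiniteField.primitiveChar_to_Complex_isPrimitive F⟩
  set s : Finset F := {z | z ∈ nonzeroPowers F 3} with hsdef
  have hs : ∀ z, z ∈ s ↔ z ∈ nonzeroPowers F 3 := by simp [hsdef]
  have hex : ∀ c, ∃ k : ℤ, ∑ y ∈ s, ψ (c * y) = k := by
    refine exists_int_eq_sum_addChar hp ψ s fun u hu y => ?_
    rw [hs, hs]
    exact natCast_mul_mem_nonzeroPowers_iff hq hp hpn hu y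
  choose k hk using hex
  have hcub : ∀ c, cubicSum ψ c = ((3 * k c + 1 : ℤ) : ℂ) := by
    intro c
    rw [cubicSum, sum_comp_cube_eq_add hq (fun z => ψ (c * z)) s hs, hk]
    simp [add_comm]
  have hk0 : k 0 = n := by
    have := hk 0
    simp only [zero_mul, AddChar.map_zero_eq_one, sum_const, nsmul_eq_mul, mul_one,
      card_nonzero_cubes hq s hs] at this
    exact_mod_cast this.symm
  have hinv : ∀ c a : F, a ≠ 0 → k (c * a ^ 3) = k c := by
    intro c a ha
    have h := cubicSum_mul_cube ψ c ha
    rw [hcub, hcub] at h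
    have h' : 3 * k (c * a ^ 3) + 1 = 3 * k c + 1 := by exact_mod_cast h
    omega
  obtain ⟨g, -, hg⟩ := map_univ_of_cube_invariant hq k hinv
  -- The term c = 0 contributes q ^ j, and each cubic class contributes its value n times;
  -- comparison with the moments leaves a factor n to cancel.
  have hsum : ∀ j : ℕ, ∑ c, cubicSum ψ c ^ j = (3 * n + 1 : ℂ) ^ j +
      n * ((3 * k 1 + 1 : ℂ) ^ j + (3 * k g + 1 : ℂ) ^ j + (3 * k (g ^ 2) + 1 : ℂ) ^ j) := by
    intro j
    have h := congrArg (fun m => (m.map fun z : ℤ => (3 * z + 1 : ℂ) ^ j).sum) hg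
    simp only [Multiset.map_map, Multiset.map_add, Multiset.sum_add, Multiset.map_nsmul,
      Multiset.sum_nsmul, hk0] at h
    simp only [hcub]
    push_cast
    refine Eq.trans ?_ (h.trans ?_)
    · rfl
    · simp [mul_add, add_assoc]
  have hcard : (Fintype.card F : ℂ) = 3 * n + 1 := by rw [hq]; push_cast; ring
  refine ⟨k 1, k g, k (g ^ 2), ?_, ?_, ?_, ?_⟩
  · have h := hsum 1
    simp only [pow_one] at h
    rw [sum_cubicSum hψ, hcard] at h
    have h' : (k 1 + k g + k (g ^ 2) : ℂ) = -1 := by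
      apply mul_left_cancel₀ hn0
      linear_combination -h / 3
    exact_mod_cast h'
  · have h := hsum 2
    rw [sum_cubicSum_sq hq hψ, hcard] at h
    have h' : ((3 * k 1 + 1) ^ 2 + (3 * k g + 1) ^ 2 + (3 * k (g ^ 2) + 1) ^ 2 : ℂ) =
        6 * (3 * n + 1) := by
      apply mul_left_cancel₀ hn0
      linear_combination -h
    exact_mod_cast h'
  · have h := hsum 3
    rw [sum_cubicSum_cube hq hψ, hcard] at h
    have h' : ((3 * k 1 + 1) ^ 3 + (3 * k g + 1) ^ 3 + (3 * k (g ^ 2) + 1) ^ 3 : ℂ) =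
        3 * ((3 * n + 1) * (cubeSumCount (1 : F) - 3 * n + 1)) := by
      apply mul_left_cancel₀ hn0
      linear_combination -h
    exact_mod_cast h'
  · have h := congrArg (Multiset.map fun z : ℤ => (z : ℝ)) hg
    rw [Multiset.map_map] at h
    rw [paleyGraph3, graphSpectrum_cayleyGraph hψ _ _ _ s hs k hk]
    refine Eq.trans ?_ (h.trans ?_)
    · rfl
    · simp [Multiset.map_nsmul, hk0]

/-- Every element of a finite field with more than four elements is a sum of cubes. -/
theorem closure_nonzeroPowers_three (hq : Fintype.card F = 3 * n + 1) (hn : 2 ≤ n) :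
    AddSubgroup.closure (nonzeroPowers F 3) = ⊤ := by
  classical
  set K := AddSubgroup.closure (nonzeroPowers F 3) with hK
  have hone : (1 : F) ∈ K := AddSubgroup.subset_closure ⟨1, one_ne_zero, (one_pow 3).symm⟩
  have hpow : ∀ b ∈ K, ∀ j : ℕ, b ^ j ∈ K := by
    intro b hb j
    induction j with
    | zero => rwa [pow_zero]
    | succ j ih => rw [pow_succ]; exact mul_mem_closure_nonzeroPowers ih hb
  have hinv : ∀ b ∈ K, b ≠ 0 → b⁻¹ ∈ K := by
    intro b hb hb0
    have : b⁻¹ = b ^ (3 * n - 1) := by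
      refine inv_eq_of_mul_eq_one_right ?_
      rw [← pow_succ', Nat.sub_add_cancel (by omega)]
      exact pow_three_mul_eq_one hq hb0
    rw [this]
    exact hpow b hb _
  rw [eq_top_iff]
  intro z _
  by_contra hz
  -- The closure K is a subfield, so an element z outside it would make 1 and z independent over K,
  -- whence |K|² ≤ q.
  have hinj : Function.Injective fun x : K × K => (x.1 : F) + x.2 * z := by
    rintro ⟨a, b⟩ ⟨c, d⟩ h
    simp only at h
    have hbd : (b : F) = d := by
      by_contra hne
      apply hz
      have h0 : (b : F) - d ≠ 0 := sub_ne_zero.mpr hne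
      have : z = ((b : F) - d)⁻¹ * (c - a) := by
        rw [eq_inv_mul_iff_mul_eq₀ h0]
        linear_combination h
      rw [this]
      exact mul_mem_closure_nonzeroPowers (hinv _ (sub_mem b.2 d.2) h0) (sub_mem c.2 a.2)
    have hac : (a : F) = c := by
      rw [hbd] at h
      exact add_right_cancel h
    rw [Prod.mk.injEq]
    exact ⟨Subtype.ext hac, Subtype.ext hbd⟩
  have hle : Fintype.card K * Fintype.card K ≤ 3 * n + 1 := by
    rw [← hq, ← Fintype.card_prod]
    exact Fintype.card_le_of_injective _ hinj
  set s : Finset F := {z | z ∈ nonzeroPowers F 3} with hsdef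
  have hs : ∀ z, z ∈ s ↔ z ∈ nonzeroPowers F 3 := by simp [hsdef]
  have hge : n + 1 ≤ Fintype.card K := by
    have h0 : (0 : F) ∉ s := by
      rw [hs]
      exact zero_notMem_nonzeroPowers F 3
    rw [← card_nonzero_cubes hq s hs, ← card_insert_of_notMem h0,
      Fintype.card_of_subtype ({z | z ∈ K} : Finset F) (by simp)]
    refine card_le_card fun x hx => ?_
    rw [mem_filter]
    refine ⟨mem_univ _, ?_⟩
    rcases mem_insert.mp hx with rfl | hx
    · exact zero_mem K
    · exact AddSubgroup.subset_closure ((hs x).mp hx)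
  -- (n + 1)² > 3n + 1 as soon as n ≥ 2; the field with four elements is the exception.
  nlinarith

theorem connected_paleyGraph3 (hq : Fintype.card F = 3 * n + 1) (hn : 2 ≤ n) :
    (paleyGraph3 F).Connected := by
  have key : ∀ k ∈ AddSubgroup.closure (nonzeroPowers F 3), ∀ v,
      (paleyGraph3 F).Reachable v (v + k) := by
    intro k hk
    induction hk using AddSubgroup.closure_induction with
    | mem x hx =>
      intro v
      apply SimpleGraph.Adj.reachable
      change v + x - v ∈ nonzeroPowers F 3
      rwa [add_sub_cancel_left]
    | zero => intro v; rw [add_zero]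
    | add x y _ _ hx hy => intro v; rw [← add_assoc]; exact (hx v).trans (hy _)
    | neg x _ hx =>
      intro v
      have := hx (v + -x)
      rw [neg_add_cancel_right] at this
      exact this.symm
  refine ⟨fun v w => ?_⟩
  have := key (w - v) (by rw [closure_nonzeroPowers_three hq hn]; trivial) v
  rwa [add_sub_cancel] at this

/-- The number of ways to write an element as a difference of two nonzero cubes. -/
noncomputable def cubeDifferenceCount (d : F) : ℕ :=
  Nat.card {u : F // u ∈ nonzeroPowers F 3 ∧ u - d ∈ nonzeroPowers F 3}

theorem cubeDifferenceCount_mul (hq : Fintype.card F = 3 * n + 1) {r : F}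
    (hr : r ∈ nonzeroPowers F 3) (d : F) :
    cubeDifferenceCount (r * d) = cubeDifferenceCount d := by
  have hr0 : r ≠ 0 := by
    rintro rfl
    exact zero_notMem_nonzeroPowers F 3 hr
  refine (Nat.card_congr ((Equiv.mulLeft₀ r hr0).subtypeEquiv fun u => ?_)).symm
  rw [mem_nonzeroPowers_three_iff hq] at hr
  change _ ↔ r * u ∈ _ ∧ r * u - r * d ∈ _
  simp only [← mul_sub, mem_nonzeroPowers_three_iff hq, mul_pow, hr, one_mul]

theorem pow_mem_nonzeroPowers_three_iff (hq : Fintype.card F = 3 * n + 1) {j : ℕ}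
    (hj : Nat.Coprime j 3) {z : F} : z ^ j ∈ nonzeroPowers F 3 ↔ z ∈ nonzeroPowers F 3 := by
  rw [mem_nonzeroPowers_three_iff hq, mem_nonzeroPowers_three_iff hq]
  constructor
  · intro h
    have hz : z ≠ 0 := by
      rintro rfl
      rw [← pow_mul, zero_pow] at h
      · exact zero_ne_one h
      · refine Nat.mul_ne_zero ?_ (pos_of_card hq).ne'
        rintro rfl
        norm_num at hj
    have h3 := pow_three_mul_eq_one hq hz
    rw [mul_comm, pow_mul] at h3
    rw [← pow_mul, mul_comm, pow_mul] at h
    have := pow_gcd_eq_one.mpr ⟨h, h3⟩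
    rwa [hj, pow_one] at this
  · intro h
    rw [← pow_mul, mul_comm, pow_mul, h, one_pow]

theorem cubeDifferenceCount_pow_char (hq : Fintype.card F = 3 * n + 1) {p : ℕ} [Fact p.Prime]
    [CharP F p] (hp3 : Nat.Coprime p 3) (d : F) :
    cubeDifferenceCount (d ^ p) = cubeDifferenceCount d := by
  have hbij : Function.Bijective (frobenius F p) :=
    Finite.injective_iff_bijective.mp (frobenius_inj F p)
  refine (Nat.card_congr ((Equiv.ofBijective _ hbij).subtypeEquiv fun u => ?_)).symm
  rw [Equiv.ofBijective_apply, frobenius_def, ← sub_pow_char, pow_mem_nonzeroPowers_three_iff hq hp3,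
    pow_mem_nonzeroPowers_three_iff hq hp3]

/-- The class of a nonzero c is the cube root of unity `c ^ n`. Scaling by cubes preserves the count
within a class, and Frobenius, which sends ω to ω ^ p = ω², exchanges the two classes of noncubes.
-/
theorem cubeDifferenceCount_eq_of_not_mem (hq : Fintype.card F = 3 * n + 1) {p : ℕ}
    [Fact p.Prime] [CharP F p] (hp3 : p % 3 = 2) {d e : F} (hd0 : d ≠ 0) (he0 : e ≠ 0)
    (hd : d ∉ nonzeroPowers F 3) (he : e ∉ nonzeroPowers F 3) :
    cubeDifferenceCount d = cubeDifferenceCount e := by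
  have hcop : Nat.Coprime p 3 := by
    rw [Nat.coprime_comm, Nat.Prime.coprime_iff_not_dvd Nat.prime_three]
    omega
  have main : ∀ c : F, c ≠ 0 → c ^ n = d ^ n →
      cubeDifferenceCount d = cubeDifferenceCount c := by
    intro c hc h
    have hr : d / c ∈ nonzeroPowers F 3 := by
      rw [mem_nonzeroPowers_three_iff hq, div_pow, h, div_self (pow_ne_zero n hd0)]
    rw [← cubeDifferenceCount_mul hq hr c, div_mul_cancel₀ d hc]
  rw [mem_nonzeroPowers_three_iff hq] at hd he
  have root : ∀ c : F, c ≠ 0 → c ^ n ≠ 1 → (c ^ n) ^ 2 + c ^ n + 1 = 0 := by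
    intro c hc hc1
    have h3 := pow_three_mul_eq_one hq hc
    rw [mul_comm, pow_mul] at h3
    refine (mul_eq_zero.mp (?_ : (c ^ n - 1) * _ = 0)).resolve_left (sub_ne_zero.mpr hc1)
    linear_combination h3
  have h1 := root d hd0 hd
  have h2 := root e he0 he
  have h : (e ^ n - d ^ n) * (e ^ n - (d ^ n) ^ 2) = 0 := by
    linear_combination h2 + (d ^ n - 1 - e ^ n) * h1
  rcases mul_eq_zero.mp h with h | h
  · exact main e he0 (sub_eq_zero.mp h)
  · rw [← cubeDifferenceCount_pow_char hq hcop e]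
    refine main _ (pow_ne_zero p he0) ?_
    have h3 : (d ^ n) ^ 3 = 1 := by linear_combination (d ^ n - 1) * h1
    rw [← pow_mul, mul_comm, pow_mul, sub_eq_zero.mp h, ← pow_mul]
    obtain ⟨j, hj⟩ : ∃ j, p = 3 * j + 2 := ⟨p / 3, by omega⟩
    rw [hj, show 2 * (3 * j + 2) = 3 * (2 * j + 1) + 1 by ring, pow_succ, pow_mul, h3, one_pow,
      one_mul]

theorem isStronglyRegular_paleyGraph3 (hq : Fintype.card F = 3 * n + 1) {p : ℕ}
    [Fact p.Prime] [CharP F p] (hp3 : p % 3 = 2) : IsStronglyRegular (paleyGraph3 F) := by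
  classical
  obtain ⟨g, hg0, hg, hgo⟩ := exists_generator_of_card hq
  have hgn : g ∉ nonzeroPowers F 3 := by
    rw [mem_nonzeroPowers_three_iff hq, hgo]
    intro h
    have := Nat.le_of_dvd (pos_of_card hq) h
    have := pos_of_card hq
    omega
  have hadj : ∀ v w, (paleyGraph3 F).Adj v w ↔ w - v ∈ nonzeroPowers F 3 := fun _ _ => Iff.rfl
  have hone : (1 : F) ∈ nonzeroPowers F 3 := ⟨1, one_ne_zero, (one_pow 3).symm⟩
  have hcommon : ∀ v w, Nat.card ((paleyGraph3 F).commonNeighbors v w) =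
      cubeDifferenceCount (w - v) := by
    intro v w
    refine Nat.card_congr ((Equiv.subRight v).subtypeEquiv fun u => ?_)
    simp [SimpleGraph.mem_commonNeighbors, hadj]
  refine ⟨fun h => ?_, fun h => ?_, Fintype.card F, Nat.card (nonzeroPowers F 3),
    cubeDifferenceCount (1 : F), cubeDifferenceCount g, rfl, fun v => ?_, fun v w h => ?_,
    fun v w hne h => ?_⟩
  · apply hgn
    have : (paleyGraph3 F).Adj 0 g := by
      rw [h, SimpleGraph.top_adj]
      exact hg0.symm
    rwa [hadj, sub_zero] at this
  · have : (paleyGraph3 F).Adj 0 1 := by rwa [hadj, sub_zero]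
    rw [h] at this
    exact this
  · rw [← SimpleGraph.card_neighborSet_eq_degree, ← Nat.card_eq_fintype_card]
    refine Nat.card_congr ((Equiv.subRight v).subtypeEquiv fun u => ?_)
    simp [hadj]
  · rw [← Nat.card_eq_fintype_card, hcommon, ← mul_one (w - v), cubeDifferenceCount_mul hq h]
  · rw [← Nat.card_eq_fintype_card, hcommon]
    exact cubeDifferenceCount_eq_of_not_mem hq hp3 (sub_ne_zero.mpr hne.symm) hg0 h hgn

end PaleyGraphStructure

/-! ### Integer arithmetic: Lucas, Eisenstein norms, and the form a² + 27b². -/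

section CubicArithmetic

/-- All base p digits of n equal k = (p - 1)/3, and 2k < p, so doubling n causes no carry. Lucas's
theorem removes one digit at a time. -/
theorem not_dvd_centralBinom_of_three_mul_add_one {p : ℕ} (hp : p.Prime) (hp3 : p % 3 = 1)
    {m n : ℕ} (h : 3 * n + 1 = p ^ m) : ¬ p ∣ (2 * n).choose n := by
  have := Fact.mk hp
  obtain ⟨k, hk⟩ : ∃ k, p = 3 * k + 1 := ⟨p / 3, by omega⟩
  induction m generalizing n with
  | zero =>
    obtain rfl : n = 0 := by simpa using h
    simpa using hp.one_lt.ne'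
  | succ m ih =>
    have hmod : p ^ m % 3 = 1 := by simp [Nat.pow_mod, hp3]
    obtain ⟨j, hj⟩ : ∃ j, 3 * j + 1 = p ^ m := ⟨p ^ m / 3, by omega⟩
    have hn : n = k + p * j := by
      rw [pow_succ, ← hj] at h
      have : 3 * n + 1 = 3 * (k + p * j) + 1 := by
        rw [h]
        nlinarith
      omega
    have h2n : 2 * n = 2 * k + p * (2 * j) := by rw [hn]; ring
    have hL := Choose.choose_modEq_choose_mod_mul_choose_div_nat (n := 2 * n) (k := n) (p := p)
    rw [h2n, hn, Nat.add_mul_mod_self_left, Nat.add_mul_mod_self_left,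
      Nat.add_mul_div_left _ _ hp.pos, Nat.add_mul_div_left _ _ hp.pos,
      Nat.mod_eq_of_lt (by omega : 2 * k < p), Nat.mod_eq_of_lt (by omega : k < p),
      Nat.div_eq_of_lt (by omega : 2 * k < p), Nat.div_eq_of_lt (by omega : k < p), zero_add,
      zero_add] at hL
    rw [h2n, hn, hL.dvd_iff dvd_rfl, hp.dvd_mul, not_or]
    refine ⟨fun hd => ?_, ih hj⟩
    have h1 : p ∣ (2 * k).factorial := by
      rw [← Nat.choose_mul_factorial_mul_factorial (by omega : k ≤ 2 * k), mul_assoc]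
      exact hd.mul_right _
    rw [hp.dvd_factorial] at h1
    omega

/-- The prime p is inert in the Eisenstein integers: a root w of X² + X + 1 mod p has w³ = 1, and p
- 1 ≡ 1 mod 3 then turns Fermat into w = 1, so 3 = 0. -/
theorem dvd_of_dvd_eisenstein_norm {p : ℕ} (hp : p.Prime) (hp3 : p % 3 = 2) {x y : ℤ}
    (h : (p : ℤ) ∣ x ^ 2 + x * y + y ^ 2) : (p : ℤ) ∣ x ∧ (p : ℤ) ∣ y := by
  have := Fact.mk hp
  have h' : (x : ZMod p) ^ 2 + x * y + y ^ 2 = 0 := by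
    rw [← ZMod.intCast_zmod_eq_zero_iff_dvd] at h
    exact_mod_cast h
  have h3 : (3 : ZMod p) ≠ 0 := by
    intro h0
    have h3' : ((3 : ℕ) : ZMod p) = 0 := by exact_mod_cast h0
    rw [ZMod.natCast_eq_zero_iff, Nat.prime_dvd_prime_iff_eq hp Nat.prime_three] at h3'
    omega
  have hy : (y : ZMod p) = 0 := by
    by_contra hy
    obtain ⟨w, hw⟩ : ∃ w : ZMod p, (x : ZMod p) = w * y := ⟨x / y, by field_simp⟩
    have hw1 : w ^ 2 + w + 1 = 0 := by
      apply mul_right_cancel₀ (pow_ne_zero 2 hy)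
      rw [hw] at h'
      linear_combination h'
    have hw0 : w ≠ 0 := by
      rintro rfl
      simp at hw1
    have hw3 : w ^ 3 = 1 := by linear_combination (w - 1) * hw1
    have hf := ZMod.pow_card_sub_one_eq_one hw0
    obtain ⟨j, hj⟩ : ∃ j, p - 1 = 3 * j + 1 := ⟨p / 3, by omega⟩
    rw [hj, pow_succ, pow_mul, hw3, one_pow, one_mul] at hf
    apply h3
    rw [hf] at hw1
    linear_combination hw1
  have hx : (x : ZMod p) = 0 := by
    rw [hy] at h'
    simpa using h'
  rw [ZMod.intCast_zmod_eq_zero_iff_dvd] at hx hy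
  exact ⟨hx, hy⟩

theorem exists_eq_pow_mul_of_eisenstein_norm {p : ℕ} (hp : p.Prime) (hp3 : p % 3 = 2) (N : ℤ)
    (t : ℕ) {x y : ℤ} (h : x ^ 2 + x * y + y ^ 2 = N * (p ^ t) ^ 2) :
    ∃ u v : ℤ, x = p ^ t * u ∧ y = p ^ t * v ∧ u ^ 2 + u * v + v ^ 2 = N := by
  induction t generalizing x y with
  | zero => exact ⟨x, y, by simp, by simp, by simpa using h⟩
  | succ t ih =>
    obtain ⟨⟨u, rfl⟩, ⟨v, rfl⟩⟩ := dvd_of_dvd_eisenstein_norm hp hp3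
      (Dvd.intro _ (by rw [h]; ring : (p : ℤ) * (N * p * (p ^ t) ^ 2) = _))
    have hp0 : (p : ℤ) ^ 2 ≠ 0 := pow_ne_zero 2 (by exact_mod_cast hp.ne_zero)
    obtain ⟨u', v', hu, hv, huv⟩ := ih (x := u) (y := v)
      (mul_left_cancel₀ hp0 (by linear_combination h))
    exact ⟨u', v', by rw [hu]; ring, by rw [hv]; ring, huv⟩

theorem eisenstein_norm_eq_three {u v : ℤ} (h : u ^ 2 + u * v + v ^ 2 = 3) (huv : 3 ∣ u - v) :
    ∃ ε : ℤ, (ε = 1 ∨ ε = -1) ∧ 3 ∣ u - ε ∧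
      ({u, v, -(u + v)} : Multiset ℤ) = {ε, ε, -2 * ε} := by
  have hu1 : u ≤ 2 := by nlinarith [sq_nonneg (u + 2 * v)]
  have hu2 : -2 ≤ u := by nlinarith [sq_nonneg (u + 2 * v)]
  have hv1 : v ≤ 2 := by nlinarith [sq_nonneg (v + 2 * u)]
  have hv2 : -2 ≤ v := by nlinarith [sq_nonneg (v + 2 * u)]
  interval_cases u <;> interval_cases v <;> first
    | omega
    | exact ⟨1, by decide⟩
    | exact ⟨-1, by decide⟩

/-- The three values of the cubic exponential sum in the semiprimitive case. -/
theorem cubic_values_of_mod_three_eq_two {p : ℕ} (hp : p.Prime) (hp3 : p % 3 = 2) {t : ℕ}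
    {k₀ k₁ k₂ : ℤ} (h1 : k₀ + k₁ + k₂ = -1)
    (h2 : (3 * k₀ + 1) ^ 2 + (3 * k₁ + 1) ^ 2 + (3 * k₂ + 1) ^ 2 = 6 * ((p : ℤ) ^ t) ^ 2) :
    ({3 * k₀ + 1, 3 * k₁ + 1, 3 * k₂ + 1} : Multiset ℤ) =
      {(-1 : ℤ) ^ t * p ^ t, (-1 : ℤ) ^ t * p ^ t, -2 * ((-1 : ℤ) ^ t * p ^ t)} := by
  have h2' : (3 * k₀ + 1) ^ 2 + (3 * k₀ + 1) * (3 * k₁ + 1) + (3 * k₁ + 1) ^ 2 =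
      3 * ((p : ℤ) ^ t) ^ 2 := by
    have : k₂ = -1 - k₀ - k₁ := by omega
    rw [this] at h2
    linarith
  obtain ⟨u, v, hu, hv, huv⟩ := exists_eq_pow_mul_of_eisenstein_norm hp hp3 3 t h2'
  set s : ℤ := (p : ℤ) ^ t with hs
  -- The sign comes from here: 3k + 1 = s f forces f ≡ (-1) ^ t mod 3.
  have hsmod : s ≡ (-1) ^ t [ZMOD 3] := by
    refine Int.ModEq.pow t ?_
    have : (p : ℤ) % 3 = 2 := by exact_mod_cast hp3
    exact this
  have hsq : ((-1 : ℤ) ^ t) * (-1) ^ t = 1 := by rw [← mul_pow]; norm_num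
  have hmod : ∀ f k : ℤ, 3 * k + 1 = s * f → f ≡ (-1) ^ t [ZMOD 3] := by
    intro f k hk
    have e1 : s * f ≡ 1 [ZMOD 3] := by
      rw [← hk]
      exact (Int.modEq_iff_dvd.mpr ⟨-k, by ring⟩)
    have e2 := (hsmod.mul_right f).symm.trans e1
    have e3 := e2.mul_left ((-1) ^ t)
    rwa [← mul_assoc, hsq, one_mul, mul_one] at e3
  have hu' := hmod u k₀ hu
  obtain ⟨ε, hε, hεu, hset⟩ := eisenstein_norm_eq_three huv
    (((hmod v k₁ hv).trans hu'.symm).dvd)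
  have hεt : ε = (-1) ^ t := by
    have e : ε ≡ (-1) ^ t [ZMOD 3] := (Int.modEq_iff_dvd.mpr hεu).trans hu'
    rcases neg_one_pow_eq_or ℤ t with ht | ht <;> rw [ht] at e ⊢ <;>
      rcases hε with rfl | rfl <;> first
        | rfl
        | exact absurd e (by decide)
  have hset' := congrArg (Multiset.map fun z => s * z) hset
  have hk2 : 3 * k₂ + 1 = s * -(u + v) := by linear_combination 3 * h1 - hu - hv
  rw [hu, hv, hk2]
  rw [hεt] at hset'
  simp only [Multiset.insert_eq_cons, Multiset.map_cons, Multiset.map_singleton] at hset' ⊢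
  rw [hset', mul_comm s, show s * (-2 * (-1) ^ t) = -2 * ((-1) ^ t * s) by ring]

theorem cubic_representation_of_modEq {s : ℤ} {f₀ f₁ f₂ : ℤ} (h0 : f₀ ≡ 1 [ZMOD 3])
    (hsum : f₀ + f₁ + f₂ = 0) (hsq : f₀ ^ 2 + f₁ ^ 2 + f₂ ^ 2 = 6 * s) (h9 : 9 ∣ f₂ - f₁) :
    ∃ a b : ℤ, 4 * s = a ^ 2 + 27 * b ^ 2 ∧ a ≡ 1 [ZMOD 3] ∧
      a = f₀ ∧ 2 * f₁ = -(a + 9 * b) ∧ 2 * f₂ = -(a - 9 * b) := by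
  obtain ⟨b, hb⟩ := h9
  refine ⟨f₀, b, ?_, h0, rfl, by omega, by omega⟩
  obtain rfl : f₂ = f₁ + 9 * b := by omega
  obtain rfl : f₀ = -2 * f₁ - 9 * b := by omega
  linarith

/-- The three values of the cubic exponential sum in the case `p ≡ 1 (mod 3)`. -/
theorem cubic_values_of_mod_three_eq_one {p : ℕ} (hp : p.Prime) (hp3 : p % 3 = 1) {t : ℕ}
    {k₀ k₁ k₂ c : ℤ} (h1 : k₀ + k₁ + k₂ = -1)
    (h2 : (3 * k₀ + 1) ^ 2 + (3 * k₁ + 1) ^ 2 + (3 * k₂ + 1) ^ 2 = 6 * ((p : ℤ) ^ t) ^ 3)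
    (h3 : (3 * k₀ + 1) ^ 3 + (3 * k₁ + 1) ^ 3 + (3 * k₂ + 1) ^ 3 = 3 * (((p : ℤ) ^ t) ^ 3 * c))
    (hc : ¬ (p : ℤ) ∣ c) :
    ∃ a b f₁ f₂ : ℤ, 4 * (p : ℤ) ^ t = a ^ 2 + 27 * b ^ 2 ∧ a ≡ 1 [ZMOD 3] ∧
      IsCoprime a (p : ℤ) ∧ 2 * f₁ = -(a + 9 * b) ∧ 2 * f₂ = -(a - 9 * b) ∧
      ({3 * k₀ + 1, 3 * k₁ + 1, 3 * k₂ + 1} : Multiset ℤ) =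
        {a * p ^ t, f₁ * p ^ t, f₂ * p ^ t} := by
  set s : ℤ := (p : ℤ) ^ t with hs
  have hs0 : s ≠ 0 := pow_ne_zero t (by exact_mod_cast hp.ne_zero)
  have hsmod : s ≡ 1 [ZMOD 3] := by
    have : (p : ℤ) ≡ 1 [ZMOD 3] := by
      have : (p : ℤ) % 3 = 1 := by exact_mod_cast hp3
      exact this
    simpa using this.pow t
  -- The three values have elementary symmetric functions 0, -3s³ and s³c, so each is a root of X³ -
  -- 3s³X - s³c; hence s³ ∣ e³.
  have hdvd : ∀ e : ℤ, e ^ 3 = s ^ 3 * (3 * e + c) → s ∣ e := fun e he =>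
    (Int.pow_dvd_pow_iff (by norm_num : 3 ≠ 0)).mp ⟨_, he⟩
  have hmod : ∀ f k : ℤ, 3 * k + 1 = s * f → f ≡ 1 [ZMOD 3] := by
    intro f k hk
    have e1 : s * f ≡ 1 [ZMOD 3] := by
      rw [← hk]
      exact (Int.modEq_iff_dvd.mpr ⟨-k, by ring⟩)
    have e2 := (hsmod.mul_right f).symm.trans e1
    rwa [one_mul] at e2
  obtain rfl : k₂ = -1 - k₀ - k₁ := by omega
  have e2 : 3 * k₀ ^ 2 + 3 * k₁ ^ 2 + 3 * k₀ * k₁ + 3 * k₀ + 3 * k₁ + 1 = s ^ 3 := by linarith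
  have e3 : (3 * k₀ + 1) * (3 * k₁ + 1) * (3 * (-1 - k₀ - k₁) + 1) = s ^ 3 * c := by linarith
  obtain ⟨f₀, hf0⟩ := hdvd (3 * k₀ + 1)
    (by linear_combination e3 + 3 * (3 * k₀ + 1) * e2)
  obtain ⟨f₁, hf1⟩ := hdvd (3 * k₁ + 1)
    (by linear_combination e3 + 3 * (3 * k₁ + 1) * e2)
  obtain ⟨f₂, hf2⟩ := hdvd (3 * (-1 - k₀ - k₁) + 1)
    (by linear_combination e3 + 3 * (3 * (-1 - k₀ - k₁) + 1) * e2)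
  have hsum : f₀ + f₁ + f₂ = 0 := by
    apply mul_left_cancel₀ hs0
    linear_combination -hf0 - hf1 - hf2
  have m0 := hmod f₀ _ hf0
  have m1 := hmod f₁ _ hf1
  have m2 := hmod f₂ _ hf2
  rw [hf0, hf1, hf2] at h2 h3 ⊢
  have hsq : f₀ ^ 2 + f₁ ^ 2 + f₂ ^ 2 = 6 * s := by
    apply mul_left_cancel₀ (pow_ne_zero 2 hs0)
    linear_combination h2
  have hprod : f₀ * f₁ * f₂ = c := by
    obtain rfl : f₂ = -f₀ - f₁ := by omega
    apply mul_left_cancel₀ (pow_ne_zero 3 hs0)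
    linarith
  have hcop : ∀ f : ℤ, f ∣ c → IsCoprime f (p : ℤ) := by
    intro f hf
    refine ((Nat.prime_iff_prime_int.mp hp).coprime_iff_not_dvd.mpr fun h => hc (h.trans hf)).symm
  have d0 : f₀ ∣ c := ⟨f₁ * f₂, by rw [← hprod]; ring⟩
  have d1 : f₁ ∣ c := ⟨f₀ * f₂, by rw [← hprod]; ring⟩
  have d2 : f₂ ∣ c := ⟨f₀ * f₁, by rw [← hprod]; ring⟩
  -- Write fᵢ = 1 + 3uᵢ. The sum 0 gives ∑ uᵢ = -1, so the uᵢ are not pairwise distinct mod 3.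
  have hcases : 9 ∣ f₂ - f₁ ∨ 9 ∣ f₂ - f₀ ∨ 9 ∣ f₁ - f₀ := by
    obtain ⟨u, hu⟩ := m1.symm.dvd
    obtain ⟨v, hv⟩ := m2.symm.dvd
    have hu3 : u % 3 = 0 ∨ u % 3 = 1 ∨ u % 3 = 2 := by omega
    have hv3 : v % 3 = 0 ∨ v % 3 = 1 ∨ v % 3 = 2 := by omega
    rcases hu3 with h | h | h <;> rcases hv3 with h' | h' | h' <;> omega
  rcases hcases with h | h | h
  · obtain ⟨a, b, hab, ha, rfl, hb1, hb2⟩ := cubic_representation_of_modEq m0 hsum hsq h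
    refine ⟨a, b, f₁, f₂, hab, ha, hcop _ d0, hb1, hb2, ?_⟩
    simp only [mul_comm]
  · obtain ⟨a, b, hab, ha, rfl, hb1, hb2⟩ := cubic_representation_of_modEq (f₁ := f₀) (f₂ := f₂) m1
      (by omega) (by linarith : _ = 6 * s) h
    refine ⟨a, b, f₀, f₂, hab, ha, hcop _ d1, hb1, hb2, ?_⟩
    simp only [mul_comm, Multiset.insert_eq_cons]
    rw [Multiset.cons_swap]
  · obtain ⟨a, b, hab, ha, rfl, hb1, hb2⟩ := cubic_representation_of_modEq (f₁ := f₀) (f₂ := f₁) m2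
      (by omega) (by linarith : _ = 6 * s) h
    refine ⟨a, b, f₀, f₁, hab, ha, hcop _ d2, hb1, hb2, ?_⟩
    simp only [mul_comm, Multiset.insert_eq_cons, ← Multiset.singleton_add]
    abel

/-- Uniqueness of `4 p ^ t = a ^ 2 + 27 b ^ 2` with `a` prime to `p`. -/
theorem cubic_representation_unique {p : ℕ} (hp : p.Prime) (hp2 : p ≠ 2) {t : ℕ}
    (ht : t ≠ 0) {a b a' b' : ℤ} (h : 4 * (p : ℤ) ^ t = a ^ 2 + 27 * b ^ 2)
    (h' : 4 * (p : ℤ) ^ t = a' ^ 2 + 27 * b' ^ 2) (ha : a ≡ 1 [ZMOD 3]) (ha' : a' ≡ 1 [ZMOD 3])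
    (hc : IsCoprime a (p : ℤ)) (hc' : IsCoprime a' (p : ℤ)) :
    a' = a ∧ (b' = b ∨ b' = -b) := by
  have hpp : Prime (p : ℤ) := Nat.prime_iff_prime_int.mp hp
  set s : ℤ := (p : ℤ) ^ t with hs
  have hs0 : 0 < s := pow_pos (by exact_mod_cast hp.pos) t
  have hps : (p : ℤ) ∣ s := dvd_pow_self _ ht
  have fin : a ^ 2 * b' ^ 2 = a' ^ 2 * b ^ 2 → a' = a ∧ (b' = b ∨ b' = -b) := by
    intro e
    have e1 : s * (b' ^ 2 - b ^ 2) = 0 := by nlinarith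
    have e2 : b' ^ 2 = b ^ 2 := by
      have := (mul_eq_zero.mp e1).resolve_left hs0.ne'
      linarith
    have e3 : a' ^ 2 = a ^ 2 := by linarith
    refine ⟨?_, sq_eq_sq_iff_eq_or_eq_neg.mp e2⟩
    rcases sq_eq_sq_iff_eq_or_eq_neg.mp e3 with e4 | e4
    · exact e4
    · unfold Int.ModEq at ha ha'
      omega
  -- A nonzero multiple z of s would give 27z² ≥ 27s² > 16s².
  have small : ∀ z y : ℤ, s ∣ z → 16 * s ^ 2 = y ^ 2 + 27 * z ^ 2 → z = 0 := by
    rintro _ y ⟨j, rfl⟩ hz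
    by_contra hne
    have hj : j ≠ 0 := by
      rintro rfl
      simp at hne
    have hj0 : 0 < j ^ 2 := by positivity
    have hj1 : 1 ≤ j ^ 2 := hj0
    nlinarith [sq_nonneg y, mul_le_mul_of_nonneg_left hj1 (sq_nonneg s), pow_pos hs0 2]
  have hXY : s ∣ (a * b' - a' * b) * (a * b' + a' * b) :=
    ⟨4 * (b' ^ 2 - b ^ 2), by linear_combination b' ^ 2 * -h + b ^ 2 * h'⟩
  have hnot : ¬ ((p : ℤ) ∣ a * b' - a' * b ∧ (p : ℤ) ∣ a * b' + a' * b) := by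
    rintro ⟨x1, x2⟩
    have x3 : (p : ℤ) ∣ 2 * (a * b') := by
      have := dvd_add x1 x2
      ring_nf at this ⊢
      exact this
    have hp2' : ¬ (p : ℤ) ∣ 2 := by
      intro hd
      have : p ∣ 2 := by exact_mod_cast hd
      exact hp2 ((Nat.prime_dvd_prime_iff_eq hp Nat.prime_two).mp this)
    have hb : (p : ℤ) ∣ b' :=
      hc.symm.dvd_of_dvd_mul_left ((hpp.dvd_or_dvd x3).resolve_left hp2')
    have : (p : ℤ) ∣ a' ^ 2 := by
      have e : a' ^ 2 = 4 * s - 27 * b' * b' := by linarith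
      rw [e]
      exact dvd_sub (hps.mul_left 4) (hb.mul_left _)
    exact hpp.not_isUnit (hc'.isUnit_of_dvd' (hpp.dvd_of_dvd_pow this) dvd_rfl)
  -- As p divides at most one of the two factors, s divides one of them entirely. Composing the two
  -- representations of 4s in the matching way writes 16s² as y² + 27z² with that factor as z, so it
  -- vanishes.
  by_cases hX : (p : ℤ) ∣ a * b' - a' * b
  · have hY : ¬ (p : ℤ) ∣ a * b' + a' * b := fun hY => hnot ⟨hX, hY⟩
    have hd := ((hpp.coprime_iff_not_dvd.mpr hY).pow_left (m := t)).dvd_of_dvd_mul_right hXY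
    have := small _ (a * a' + 27 * b * b') hd
      (by linear_combination 4 * s * h + (a ^ 2 + 27 * b ^ 2) * h')
    exact fin (by linear_combination (a * b' + a' * b) * this)
  · have hd := ((hpp.coprime_iff_not_dvd.mpr hX).pow_left (m := t)).dvd_of_dvd_mul_left hXY
    have := small _ (a * a' - 27 * b * b') hd
      (by linear_combination 4 * s * h + (a ^ 2 + 27 * b ^ 2) * h')
    exact fin (by linear_combination (a * b' - a' * b) * this)

end CubicArithmetic

/-! ### From integer triples to multisets of real eigenvalues, and their distinctness. -/

section PaleyGraphSpectrum

theorem nsmul_triple_eq_replicate {n : ℕ} {k₀ k₁ k₂ e₀ e₁ e₂ : ℤ}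
    (h : ({3 * k₀ + 1, 3 * k₁ + 1, 3 * k₂ + 1} : Multiset ℤ) = {e₀, e₁, e₂}) :
    n • ({(k₀ : ℝ), (k₁ : ℝ), (k₂ : ℝ)} : Multiset ℝ) =
      Multiset.replicate n (((e₀ : ℝ) - 1) / 3) + Multiset.replicate n (((e₁ : ℝ) - 1) / 3) +
        Multiset.replicate n (((e₂ : ℝ) - 1) / 3) := by
  have h' := congrArg (Multiset.map fun e : ℤ => ((e : ℝ) - 1) / 3) h
  have hk : ∀ k : ℤ, (((3 * k + 1 : ℤ) : ℝ) - 1) / 3 = k := by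
    intro k
    push_cast
    ring
  simp only [Multiset.insert_eq_cons, Multiset.map_cons, Multiset.map_singleton, hk] at h' ⊢
  rw [h']
  simp only [← Multiset.singleton_add, nsmul_add, Multiset.nsmul_singleton, add_assoc]

theorem rpow_one_third_of_eq_cube {q s : ℕ} (h : q = s ^ 3) :
    (q : ℝ) ^ ((1 : ℝ) / 3) = s := by
  rw [h, Nat.cast_pow, show (1 : ℝ) / 3 = ((3 : ℕ) : ℝ)⁻¹ by norm_num]
  exact Real.pow_rpow_inv_natCast (Nat.cast_nonneg s) (by norm_num)

theorem sqrt_of_eq_sq {q s : ℕ} (h : q = s ^ 2) : √(q : ℝ) = s := by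
  rw [h, Nat.cast_pow]
  exact Real.sqrt_sq (Nat.cast_nonneg s)

theorem cubicConditions_iff {p q s : ℕ} (h : q = s ^ 3) (a b : ℤ) :
    CubicConditions p q a b ↔
      4 * (s : ℤ) = a ^ 2 + 27 * b ^ 2 ∧ a ≡ 1 [ZMOD 3] ∧ IsCoprime a (p : ℤ) := by
  rw [CubicConditions, rpow_one_third_of_eq_cube h]
  refine and_congr_left fun _ => ?_
  exact_mod_cast Iff.rfl

/-- Every eigenvalue is (x s/2 - 1)/3 with an integer x, so it suffices to compare the x. For n it
is 2s², too large since the others satisfy x² ≤ 16s; a ≡ 1 mod 3 separates 2a from -(a ± 9b), and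
these two differ because b = 0 would give p ∣ a. -/
theorem cubic_eigenvalues_nodup {p s n : ℕ} (hp : p.Prime) (hp2 : p ≠ 2) (hps : p ∣ s)
    (hn : s ^ 3 = 3 * n + 1) {a b : ℤ} (h : 4 * (s : ℤ) = a ^ 2 + 27 * b ^ 2)
    (ha : a ≡ 1 [ZMOD 3]) (hc : IsCoprime a (p : ℤ)) :
    [(n : ℝ), ((a : ℝ) * s - 1) / 3, (-(1 / 2) * ((a : ℝ) + 9 * b) * s - 1) / 3,
      (-(1 / 2) * ((a : ℝ) - 9 * b) * s - 1) / 3].Nodup := by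
  have hs0 : 0 < s := by
    rcases Nat.eq_zero_or_pos s with rfl | h0
    · simp at hn
    · exact h0
  have hs3 : 3 ≤ s := (show 3 ≤ p by have := hp.two_le; omega).trans (Nat.le_of_dvd hs0 hps)
  have hnR : (n : ℝ) = ((s : ℝ) ^ 3 - 1) / 3 := by
    have : (s : ℝ) ^ 3 = 3 * n + 1 := by exact_mod_cast hn
    rw [this]
    ring
  have hs0R : (s : ℝ) ≠ 0 := by exact_mod_cast hs0.ne'
  have hb0 : b ≠ 0 := by
    rintro rfl
    have h1 : (p : ℤ) ∣ a ^ 2 := by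
      have : (p : ℤ) ∣ s := by exact_mod_cast hps
      have h2 : a ^ 2 = 4 * (s : ℤ) := by linarith
      rw [h2]
      exact this.mul_left 4
    have hpp : Prime (p : ℤ) := Nat.prime_iff_prime_int.mp hp
    exact hpp.not_isUnit (hc.isUnit_of_dvd' (hpp.dvd_of_dvd_pow h1) dvd_rfl)
  have ha3 : ∀ j : ℤ, a ≠ 3 * j := by
    rintro j rfl
    unfold Int.ModEq at ha
    omega
  have hs3Z : (3 : ℤ) ≤ s := by exact_mod_cast hs3
  have bound : ∀ x : ℤ, x ^ 2 ≤ 16 * s → x ≠ 2 * s ^ 2 := by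
    rintro x hx rfl
    have h9 : (9 : ℤ) * s ≤ s ^ 3 := by nlinarith
    nlinarith
  have main : ∀ x y : ℤ, x ≠ y → ((x : ℝ) / 2 * s - 1) / 3 ≠ ((y : ℝ) / 2 * s - 1) / 3 := by
    intro x y hxy he
    apply hxy
    have : (x : ℝ) * s = y * s := by linarith
    exact_mod_cast mul_right_cancel₀ hs0R this
  have e0 : (n : ℝ) = (((2 * (s : ℤ) ^ 2 : ℤ) : ℝ) / 2 * s - 1) / 3 := by
    rw [hnR]; push_cast; ring
  have e1 : ((a : ℝ) * s - 1) / 3 = (((2 * a : ℤ) : ℝ) / 2 * s - 1) / 3 := by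
    push_cast; ring
  have e2 : (-(1 / 2) * ((a : ℝ) + 9 * b) * s - 1) / 3 =
      (((-(a + 9 * b) : ℤ) : ℝ) / 2 * s - 1) / 3 := by
    push_cast; ring
  have e3 : (-(1 / 2) * ((a : ℝ) - 9 * b) * s - 1) / 3 =
      (((-(a - 9 * b) : ℤ) : ℝ) / 2 * s - 1) / 3 := by
    push_cast; ring
  rw [e0, e1, e2, e3]
  simp only [List.nodup_cons, List.mem_cons, List.not_mem_nil, or_false, not_or, not_false_eq_true,
    List.nodup_nil, and_true]
  refine ⟨⟨main _ _ ?_, main _ _ ?_, main _ _ ?_⟩, ⟨main _ _ ?_, main _ _ ?_⟩, main _ _ ?_⟩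
  · exact (bound _ (by nlinarith [sq_nonneg b])).symm
  · exact (bound _ (by nlinarith [sq_nonneg (a - 3 * b)])).symm
  · exact (bound _ (by nlinarith [sq_nonneg (a + 3 * b)])).symm
  · intro he
    exact ha3 (-b) (by omega)
  · intro he
    exact ha3 b (by omega)
  · intro he
    omega

theorem semiprimitive_eigenvalues_nodup {s n : ℕ} (hs : 3 ≤ s) (hn : s ^ 2 = 3 * n + 1) :
    [(n : ℝ), ((s : ℝ) - 1) / 3, (-2 * (s : ℝ) - 1) / 3].Nodup ∧
      [(n : ℝ), (2 * (s : ℝ) - 1) / 3, (-(s : ℝ) - 1) / 3].Nodup := by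
  have hnR : (n : ℝ) = ((s : ℝ) ^ 2 - 1) / 3 := by
    have : (s : ℝ) ^ 2 = 3 * n + 1 := by exact_mod_cast hn
    rw [this]
    ring
  have hsR : (3 : ℝ) ≤ s := by exact_mod_cast hs
  rw [hnR]
  constructor <;>
  · simp only [List.nodup_cons, List.mem_cons, List.not_mem_nil, or_false, not_or,
      not_false_eq_true, List.nodup_nil, and_true]
    refine ⟨⟨fun h => ?_, fun h => ?_⟩, fun h => ?_⟩ <;> nlinarith

end PaleyGraphSpectrum

/-! ### Assembly of the two cases. -/

theorem theorem2p2 (p m q n : ℕ) (hp : p.Prime) (hq : q = p ^ m) (hq5 : 5 ≤ q)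
    (h3 : 3 ∣ (q - 1) / (p - 1)) (hn : n = (q - 1) / 3)
    (F : Type*) [Field F] [Fintype F] (hF : Fintype.card F = q) :
    (paleyGraph3 F).Connected ∧
    (∀ x ∈ graphSpectrum (paleyGraph3 F), ∃ z : ℤ, x = (z : ℝ)) ∧
    (p ≡ 1 [MOD 3] →
      (∃ t : ℕ, m = 3 * t) ∧
      (∃ a b : ℤ, CubicConditions p q a b) ∧
      (∀ a b a' b' : ℤ, CubicConditions p q a b → CubicConditions p q a' b' →
        a' = a ∧ (b' = b ∨ b' = -b)) ∧
      (∀ a b : ℤ, CubicConditions p q a b →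
        ∀ x₁ x₂ x₃ : ℝ,
          x₁ = ((a : ℝ) * (q : ℝ) ^ ((1 : ℝ) / 3) - 1) / 3 →
          x₂ = (-(1 / 2) * ((a : ℝ) + 9 * (b : ℝ)) * (q : ℝ) ^ ((1 : ℝ) / 3) - 1) / 3 →
          x₃ = (-(1 / 2) * ((a : ℝ) - 9 * (b : ℝ)) * (q : ℝ) ^ ((1 : ℝ) / 3) - 1) / 3 →
          [(n : ℝ), x₁, x₂, x₃].Nodup ∧
          graphSpectrum (paleyGraph3 F) =
            Multiset.replicate 1 (n : ℝ) + Multiset.replicate n x₁ +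
              Multiset.replicate n x₂ + Multiset.replicate n x₃)) ∧
    (p ≡ 2 [MOD 3] →
      (∃ t : ℕ, m = 2 * t) ∧
      (m ≡ 0 [MOD 4] →
        ∀ x₁ x₂ : ℝ, x₁ = (√(q : ℝ) - 1) / 3 → x₂ = (-2 * √(q : ℝ) - 1) / 3 →
          [(n : ℝ), x₁, x₂].Nodup ∧
          graphSpectrum (paleyGraph3 F) =
            Multiset.replicate 1 (n : ℝ) + Multiset.replicate (2 * n) x₁ +
              Multiset.replicate n x₂) ∧
      (m ≡ 2 [MOD 4] →
        ∀ x₁ x₂ : ℝ, x₁ = (2 * √(q : ℝ) - 1) / 3 → x₂ = (-√(q : ℝ) - 1) / 3 →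
          [(n : ℝ), x₁, x₂].Nodup ∧
          graphSpectrum (paleyGraph3 F) =
            Multiset.replicate 1 (n : ℝ) + Multiset.replicate n x₁ +
              Multiset.replicate (2 * n) x₂) ∧
      IsStronglyRegular (paleyGraph3 F)) := by
  classical
  have : Fact p.Prime := ⟨hp⟩
  have : CharP F p := charP_of_card_eq_prime_pow (hF.trans hq)
  obtain ⟨D, hD⟩ := h3
  have hgeom : ∑ i ∈ Finset.range m, p ^ i = 3 * D := by
    rw [← hD, hq, Nat.geomSum_eq hp.two_le]
  have hmul : (p - 1) * (3 * D) = q - 1 := by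
    rw [← hD, hq, Nat.mul_div_cancel']
    simpa using Nat.sub_dvd_pow_sub_pow p 1 m
  have hnD : n = (p - 1) * D := by
    rw [hn, ← hmul, mul_left_comm, Nat.mul_div_cancel_left _ (by norm_num)]
  have hqn : q = 3 * n + 1 := by
    rw [hnD, mul_left_comm, hmul]
    omega
  have hcard : Fintype.card F = 3 * n + 1 := hF.trans hqn
  have hqZ : (q : ℤ) = 3 * n + 1 := by exact_mod_cast hqn
  obtain ⟨k₀, k₁, k₂, h1, h2, h3, hspec⟩ :=
    exists_eigenvalues_paleyGraph3 hcard hp ⟨D, hnD⟩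
  rw [← hqZ] at h2 h3
  refine ⟨connected_paleyGraph3 hcard (by omega), fun x hx => ?_, fun hp1 => ?_, fun hp2 => ?_⟩
  · rw [hspec] at hx
    rcases Multiset.mem_add.mp hx with hx | hx
    · exact ⟨n, by simpa using hx⟩
    · have := Multiset.mem_of_mem_nsmul hx
      simp only [Multiset.insert_eq_cons, Multiset.mem_cons, Multiset.mem_singleton] at this
      rcases this with rfl | rfl | rfl
      exacts [⟨_, rfl⟩, ⟨_, rfl⟩, ⟨_, rfl⟩]
  · have hp3 : p % 3 = 1 := hp1
    -- For p ≡ 1 mod 3, the geometric sum (q - 1)/(p - 1) is congruent to m.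
    have hm : m % 3 = 0 := by
      have hpZ : (p : ZMod 3) = 1 := by
        exact_mod_cast (ZMod.natCast_eq_natCast_iff p 1 3).mpr hp1
      have h30 : (3 : ZMod 3) = 0 := rfl
      have h := congrArg (Nat.cast : ℕ → ZMod 3) hgeom
      push_cast at h
      rw [hpZ, h30, zero_mul] at h
      simp only [one_pow, Finset.sum_const, Finset.card_range, nsmul_eq_mul, mul_one] at h
      exact Nat.mod_eq_zero_of_dvd ((ZMod.natCast_eq_zero_iff m 3).mp h)
    obtain ⟨t, rfl⟩ : ∃ t, m = 3 * t := ⟨m / 3, by omega⟩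
    have ht : t ≠ 0 := by
      rintro rfl
      simp at hq
      omega
    have hp2 : p ≠ 2 := by omega
    have hqs : q = (p ^ t) ^ 3 := by rw [hq, ← pow_mul, mul_comm]
    have hqsZ : (q : ℤ) = ((p : ℤ) ^ t) ^ 3 := by exact_mod_cast hqs
    -- In `F`, where q = 0, this integer equals -C(2n, n).
    have hc : ¬ (p : ℤ) ∣ (cubeSumCount (1 : F) - 3 * n + 1 : ℤ) := by
      have hq0 : (3 * n + 1 : F) = 0 := by
        have := FiniteField.cast_card_eq_zero F
        rw [hcard] at this
        exact_mod_cast this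
      rw [← CharP.intCast_eq_zero_iff F p]
      push_cast
      rw [cast_cubeSumCount_one hcard]
      intro h
      have h' : ((2 * n).choose n : F) = 0 := by linear_combination -h - hq0
      rw [CharP.cast_eq_zero_iff F p] at h'
      exact not_dvd_centralBinom_of_three_mul_add_one hp hp3 (hqn.symm.trans hq) h'
    rw [hqsZ] at h2 h3
    obtain ⟨a, b, f₁, f₂, hab, ha, hac, hf1, hf2, hset⟩ :=
      cubic_values_of_mod_three_eq_one hp hp3 h1 h2 h3 hc
    have hf1R : (f₁ : ℝ) = -(1 / 2) * (a + 9 * b) := by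
      have : (2 * f₁ : ℝ) = -(a + 9 * b) := by exact_mod_cast hf1
      linarith
    have hf2R : (f₂ : ℝ) = -(1 / 2) * (a - 9 * b) := by
      have : (2 * f₂ : ℝ) = -(a - 9 * b) := by exact_mod_cast hf2
      linarith
    have hiff := cubicConditions_iff (p := p) hqs
    push_cast at hiff
    have huniq : ∀ a b a' b' : ℤ, CubicConditions p q a b → CubicConditions p q a' b' →
        a' = a ∧ (b' = b ∨ b' = -b) := by
      intro a b a' b' h h'
      rw [hiff] at h h'
      exact cubic_representation_unique hp hp2 ht h.1 h'.1 h.2.1 h'.2.1 h.2.2 h'.2.2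
    have hab' : CubicConditions p q a b := (hiff a b).mpr ⟨hab, ha, hac⟩
    refine ⟨⟨t, rfl⟩, ⟨a, b, hab'⟩, huniq, ?_⟩
    rintro a' b' h' x₁ x₂ x₃ rfl rfl rfl
    obtain ⟨rfl, hb⟩ := huniq _ _ _ _ hab' h'
    rw [rpow_one_third_of_eq_cube hqs]
    obtain ⟨h'1, h'2, h'3⟩ := (hiff _ _).mp h'
    refine ⟨cubic_eigenvalues_nodup hp hp2 (dvd_pow_self p ht) (hqs.symm.trans hqn)
      (by exact_mod_cast h'1) h'2 h'3, ?_⟩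
    rw [hspec, nsmul_triple_eq_replicate hset, Multiset.replicate_one]
    push_cast
    rw [hf1R, hf2R]
    -- Changing the sign of b only swaps the last two eigenvalues.
    rcases hb with rfl | rfl
    · simp only [add_assoc]
    · push_cast
      rw [mul_neg, ← sub_eq_add_neg, sub_neg_eq_add]
      abel
  · have hp3 : p % 3 = 2 := hp2
    have hm : m % 2 = 0 := by
      by_contra hm
      obtain ⟨j, rfl⟩ : ∃ j, m = 2 * j + 1 := ⟨m / 2, by omega⟩
      have h : q % 3 = 2 := by
        rw [hq, pow_succ, pow_mul, Nat.mul_mod, Nat.pow_mod (p ^ 2), Nat.pow_mod p 2, hp3]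
        norm_num
      omega
    obtain ⟨t, rfl⟩ : ∃ t, m = 2 * t := ⟨m / 2, by omega⟩
    have hqs : q = (p ^ t) ^ 2 := by rw [hq, ← pow_mul, mul_comm]
    have hqsZ : (q : ℤ) = ((p : ℤ) ^ t) ^ 2 := by exact_mod_cast hqs
    have hs3 : 3 ≤ p ^ t := by
      by_contra! h
      have : (p ^ t) ^ 2 ≤ 2 ^ 2 := Nat.pow_le_pow_left (by omega) 2
      omega
    rw [hqsZ] at h2
    have hset := cubic_values_of_mod_three_eq_two hp hp3 h1 h2
    have hnodup := semiprimitive_eigenvalues_nodup hs3 (hqs.symm.trans hqn)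
    refine ⟨⟨t, rfl⟩, ?_, ?_, isStronglyRegular_paleyGraph3 hcard hp3⟩
    · rintro h4 x₁ x₂ rfl rfl
      rw [sqrt_of_eq_sq hqs]
      refine ⟨hnodup.1, ?_⟩
      have ht : Even t := by
        have : 2 * t % 4 = 0 := h4
        rw [Nat.even_iff]
        omega
      rw [ht.neg_one_pow] at hset
      rw [hspec, nsmul_triple_eq_replicate hset, Multiset.replicate_one, two_mul n,
        Multiset.replicate_add]
      push_cast
      rw [one_mul]
      simp only [add_assoc]
    · rintro h4 x₁ x₂ rfl rfl
      rw [sqrt_of_eq_sq hqs]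
      refine ⟨hnodup.2, ?_⟩
      have ht : Odd t := by
        have : 2 * t % 4 = 2 := h4
        rw [Nat.odd_iff]
        omega
      rw [ht.neg_one_pow] at hset
      rw [hspec, nsmul_triple_eq_replicate hset, Multiset.replicate_one, two_mul n,
        Multiset.replicate_add]
      push_cast
      rw [neg_one_mul, neg_mul_neg]
      abel
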